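/- **Setting.** Consider a finite two-player zero-sum extensive-form game with perfect recall. $\mathcal S$ is the (non-empty) set of infosets of both players, $p(s)$ the player acting at $s$, $\mathcal A_s$ its non-empty finite action set. For a node $h$, $\mu_c(h)>0$ is the contribution of chance to its reach probability, and $\sigma_i(h)$ is the last infoset-action pair of player $i$ on the path to $h$; $\sigma(s)$ is the last such pair of player $p(s)$ on the path to $s$. Utilities $\mathcal U_1=-\mathcal U_2\in[-1,1]$ are paid at terminal nodes. For a strategy profile $\pi$, $\mu^\pi(s,a)=\mu^\pi(\sigma(s))\,\pi(a|s)$, $\mu^\pi(\emptyset)=1$, is its sequence form; $\mu_i^\pi$ is the part of player $i$, and $\mu_{-p(s)}^\pi(s)=\sum_{h\in s}\mu_c(h)\,\mu^\pi_{3-p(s)}(\sigma_{3-p(s)}(h))$. **Regularized game.** Fix $\tau>0$, $\alpha_s>0$, $\gamma_s\in(0,1]$ and a fully supported $\nu_s\in\Delta^{|\mathcal A_s|}$. Either for all $s$ $\psi_s(u)=\alpha_s(\log|\mathcal A_s|+\sum_a u_a\log u_a)$ (entropy), or for all $s$ $\psi_s(u)=\frac{\alpha_s}2\sum_a u_a^2$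 (Euclidean). Let $\Delta_s=\{u\in\Delta^{|\mathcal A_s|}:u_a\ge\gamma_s\nu_{s,a}\}$; a profile is feasible if $\pi(\cdot|s)\in\Delta_s$ for all $s$. Let $\gamma>0$ satisfy $\mu^\pi(s,a)\ge\gamma$ for all feasible $\pi$ and all $(s,a)$. Put $\psi^{\Pi_i}_{\rm bi}(\pi)=\sum_{p(s)=i}\mu^\pi(\sigma(s))\mu^\pi_{-p(s)}(s)\psi_s(\pi(\cdot|s))$. Let $\pi^*$ (with sequence form $\mu^{(\tau,\gamma),*}$) be a saddle point, over feasible strategies, of the expected utility of player 1 minus $\tau\psi^{\Pi_1}_{\rm bi}$ plus $\tau\psi^{\Pi_2}_{\rm bi}$ (player 1 maximizes, player 2 minimizes). Let $D_\psi(x,y)=\psi(x)-\psi(y)-\langle\nabla\psi(y),x-y\rangle$ and $\psi^\Pi(\mu)=\sum_{s}\mu(\sigma(s))\,\psi_s\big(\mu(s,\cdot)/\mu(\sigma(s))\big)$. **Algorithm.** The feedback $q^{(t)}(s,a)$ is one of the following three values for $\pi^{(t)}$, the same type throughout, in the regularized game, i.e. where player $p(s)$ collects the utility $\mathcal U_{p(s)}$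 at terminal nodes, $-\tau\psi_{s'}(\pi(\cdot|s'))$ at each node of an own infoset $s'$, and $+\tau\psi_{s'}(\pi(\cdot|s'))$ at each node of an infoset $s'$ of the opponent: the trajectory Q-value, which is $\frac1{\pi(a|s)}$ times the sum of (reach probability) $\times$ (collected reward) over all nodes that follow some $(h,a)$, $h\in s$; the counterfactual value, which is the trajectory Q-value divided by $\mu^\pi(\sigma(s))$; or the Q-value, which is the trajectory Q-value divided by $\sum_{h\in s}\Pr^\pi[h]$. Let $m_s^{(t)}=1/\mu^{(t)}(\sigma(s))$ (trajectory Q-value), $1$ (counterfactual value), $\mu^{(t)}_{-p(s)}(s)$ (Q-value). For all $t\ge1$ and $s$, with learning rates $\eta_s>0$, $$\pi^{(t)}(\cdot|s)=\arg\min_{u\in\Delta_s}\langle u,-q^{(t-1)}(s,\cdot)\rangle+\tfrac{\tau\mu_{-p(s)}^{(t-1)}(s)}{m_s^{(t-1)}}\psi_s(u)+\tfrac1{\eta_s}D_{\psi_s}(u,\bar\pi^{(t)}(\cdot|s)),$$ $$\bar\pi^{(t+1)}(\cdot|s)=\arg\min_{u\in\Delta_s}\langle u,-q^{(t)}(s,\cdot)\rangle+\tfrac{\tau\mu_{-p(s)}^{(t)}(s)}{m_s^{(t)}}\psi_s(u)+\tfrac1{\eta_s}D_{\psi_s}(u,\bar\pi^{(t)}(\cdot|s)),$$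 where $\bar\pi^{(1)}$ is feasible, $\pi^{(0)}=\bar\pi^{(1)}$, and $q^{(0)}$ is $0$ or the feedback at $\pi^{(0)}$. **Constants.** $\|q\|=\max_{0\le t\le T,\,s,\,a}|q^{(t)}(s,a)|$ and $w=\min_s\sum_{h\in s}\mu_c(h)$. $M_1=\gamma w$ for Q-values and $1$ otherwise; $M_2=1/\gamma$ for trajectory Q-values and $1$ otherwise. $C^{\rm diff}_s=\frac2{\alpha_s}(\|q\|+\frac{\tau\alpha_s}{M_1}\log\frac1\gamma)$ (entropy) or $\frac{|\mathcal A_s|}{\alpha_s}\|q\|+\frac{\tau}{M_1}\sqrt{|\mathcal A_s|}$ (Euclidean). Let $E=\max_s(\frac{2\|q\|}{\alpha_s}+\frac\tau{M_1}\log\frac1\gamma)$ and $F=\max_sC_s^{\rm diff}$. $(C_s^-,C_s^/)$ is $(0,0)$ for counterfactual values; $(12E/\gamma,\,12E)$ (entropy) or $(6F/\gamma^2,\,6F/(\gamma^2M_1))$ (Euclidean) for trajectory Q-values; $(12E,\,12E)$ (entropy) or $(6|s|F,\,6|s|F/M_1)$ (Euclidean) for Q-values. $C_s^{-,Q}$ is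 $12E$ (entropy) or $6|s|F$ (Euclidean), whatever the feedback. $\eta_s^{\rm anc}$ is the largest $\eta_{s'}$ over all infosets $s'$ (of either player) that precede some node of $s$, and $0$ if there is none. $C_s^\eta=\frac{\gamma}{2C_s^-}\sum_{h\in s}\mu_c(h)$ ($=\infty$ if $C_s^-=0$). **Assumptions.** For all $s$: $\eta_s^{\rm anc}/\eta_s\le\tau C_s^\eta$; (A) $\max_{h\in s}\sum_{(s',a')\sqsubseteq\sigma_i(h)}\eta_{s'}\le\eta_s$ for $i=1,2$ (the sum is over the pairs of player $i$ on the path to $h$); (B) $6\eta_s^{\rm anc}E\le1$; (C) $\eta_s(2\|q\|+\frac{\tau\alpha_s}{M_1}\log\frac1\gamma)\le1$. **Theorem.** For every $T$, $$\sum_{t=2}^TD_{\psi^\Pi}(\mu^{(\tau,\gamma),*},\mu^{\bar\pi^{(t)}})\le\frac2{\gamma w}\sum_s(C_s^/+C_s^{-,Q})\,\eta_s^{\rm anc}\mu^{(\tau,\gamma),*}(\sigma(s))\sum_{t=1}^T\big|\psi_s(\pi^{(t)}(\cdot|s))-\psi_s(\bar\pi^{(t+1)}(\cdot|s))\big|$$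 $$+\frac4{\tau\gamma w}\sum_sC_s^{\rm diff}\mu^{(\tau,\gamma),*}(\sigma(s))\|q\|\,\eta_sM_2T+\frac2{\tau\gamma w}\sum_s\frac{m_s^{(1)}}{\eta_s}\mu^{(\tau,\gamma),*}(\sigma(s))D_{\psi_s}(\pi^*(\cdot|s),\bar\pi^{(1)}(\cdot|s)).$$ In particular there is a constant $K$, depending only on the game, the feedback type and the regularization and exploration parameters ($\psi_s,\tau,\alpha,\gamma_s,\nu_s,\gamma$), such that the left-hand side is at most $K\max_s\eta_s\,T+K/\min_s\eta_s$; and for all $c_1,c_2>0$ there is a $K'$, depending only on these data and on $c_1,c_2$, such that if $T\ge2$ and $c_1/\sqrt T\le\eta_s\le c_2/\sqrt T$ for all $s$ (besides the assumptions above), then $D_{\psi^\Pi}(\mu^{(\tau,\gamma),*},\mu^{\bar\pi^{(t)}})\le K'/\sqrt T$ for some $t\in\{2,\dots,T\}$. -/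

import Mathlib

noncomputable section

namespace EFG

/-- A move of a game tree: a chance outcome, or an action taken at an infoset. -/
inductive Move (S : Type*) (A : S → Type*) (C : Type*) where
  | chance (c : C)
  | act (s : S) (a : A s)

/-- A history (node of the tree): the list of all moves from the root to the node,
with the most recent move first. The root is `[]`, a child of `h` is `m :: h`, and
`h` lies on the path from the root to `h'` exactly when `h <:+ h'`. -/
abbrev Hist (S : Type*) (A : S → Type*) (C : Type*) := List (Move S A C)

/-- What happens at a node. -/
inductive Turn (S : Type*) where
  | terminal
  | chance
  | infoset (s : S)

/-- The infoset-action pairs of player `i` on the path from the root to `h` (most recent first). -/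
def personalMoves {S : Type*} {A : S → Type*} {C : Type*} (player : S → Fin 2) (i : Fin 2) :
    Hist S A C → List (Σ s, A s)
  | [] => []
  | .chance _ :: h => personalMoves player i h
  | .act s a :: h =>
      if player s = i then ⟨s, a⟩ :: personalMoves player i h else personalMoves player i h

/-- A finite two-player zero-sum extensive-form game with perfect recall. Players `1` and `2`
are `0` and `1 : Fin 2`, the opponent of `i` is `1 - i`; `S` is the set of all infosets of both
players and `A s` the action set of the infoset `s`. -/
structure Game (S : Type*) (A : S → Type*) (C : Type*) [Fintype C] where
  /-- the player who acts at an infoset -/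
  player : S → Fin 2
  /-- all nodes of the tree -/
  nodes : Finset (Hist S A C)
  root_mem : [] ∈ nodes
  parent_mem : ∀ m h, m :: h ∈ nodes → h ∈ nodes
  /-- who moves at a node -/
  turn : Hist S A C → Turn S
  terminal_children : ∀ h ∈ nodes, turn h = .terminal → ∀ m, m :: h ∉ nodes
  infoset_children : ∀ h ∈ nodes, ∀ s, turn h = .infoset s →
    ∀ m, m :: h ∈ nodes ↔ ∃ a, m = .act s a
  /-- probability of a chance outcome at a chance node -/
  chanceProb : Hist S A C → C → ℝ
  chance_nonneg : ∀ h ∈ nodes, turn h = .chance → ∀ c, 0 ≤ chanceProb h c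
  chance_sum : ∀ h ∈ nodes, turn h = .chance → ∑ c, chanceProb h c = 1
  /-- nodes that chance reaches with probability zero are removed from the tree -/
  chance_children : ∀ h ∈ nodes, turn h = .chance →
    ∀ m, m :: h ∈ nodes ↔ ∃ c, m = .chance c ∧ 0 < chanceProb h c
  /-- utility of player 1 at terminal nodes (that of player 2 is its negative) -/
  payoff : Hist S A C → ℝ
  payoff_mem : ∀ h ∈ nodes, turn h = .terminal → payoff h ∈ Set.Icc (-1 : ℝ) 1
  infoset_nonempty : ∀ s, ∃ h ∈ nodes, turn h = .infoset s
  /-- perfect recall: the acting player's own past is the same at all nodes of an infoset -/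
  personal : S → List (Σ s, A s)
  perfect_recall : ∀ h ∈ nodes, ∀ s, turn h = .infoset s →
    personalMoves player (player s) h = personal s

/-- Strategy profiles: `π s a` is the probability `π_{p(s)}(a | s)`. -/
abbrev Profile (S : Type*) (A : S → Type*) := ∀ s : S, A s → ℝ

/-- The two regularizers on the simplices. -/
inductive Regularizer where
  | entropy
  | euclidean

/-- The three feedback types. -/
inductive Feedback where
  | counterfactual
  | trajectoryQ
  | qValue

/-- Bregman divergence. -/
def bregman {E : Type*} [NormedAddCommGroup E] [NormedSpace ℝ E] (ψ : E → ℝ) (x y : E) : ℝ :=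
  ψ x - ψ y - fderiv ℝ ψ y (x - y)

/-- The parameters of regularization and exploration. -/
structure Params (S : Type*) (A : S → Type*) [∀ s, Fintype (A s)] where
  reg : Regularizer
  /-- magnitude of the regularization -/
  τ : ℝ
  τ_pos : 0 < τ
  /-- weight of the regularizer of each infoset -/
  α : S → ℝ
  α_pos : ∀ s, 0 < α s
  /-- exploration probability at each infoset -/
  expl : S → ℝ
  expl_mem : ∀ s, expl s ∈ Set.Ioc (0 : ℝ) 1
  /-- exploration strategy at each infoset -/
  ν : Profile S A
  ν_mem : ∀ s, ν s ∈ stdSimplex ℝ (A s)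
  ν_pos : ∀ s a, 0 < ν s a

section
variable {S : Type*} {A : S → Type*} {C : Type*} [Fintype S] [∀ s, Fintype (A s)] [Fintype C]

/-! Regularizers and strategy sets -/

/-- The regularizer `ψ_s^Δ` of the infoset `s`. -/
def Params.psi (P : Params S A) (s : S) (u : A s → ℝ) : ℝ :=
  match P.reg with
  | .entropy => P.α s * (Real.log (Fintype.card (A s)) + ∑ a, u a * Real.log (u a))
  | .euclidean => P.α s / 2 * ∑ a, u a ^ 2

/-- The perturbed simplex at `s`: all `u` in the simplex with `u_a ≥ γ_s ν_{s,a}`. -/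
def Params.perturbedSimplex (P : Params S A) (s : S) : Set (A s → ℝ) :=
  {u | u ∈ stdSimplex ℝ (A s) ∧ ∀ a, P.expl s * P.ν s a ≤ u a}

/-- The profiles of the perturbed game. -/
def Params.Feasible (P : Params S A) (π : Profile S A) : Prop :=
  ∀ s, π s ∈ P.perturbedSimplex s

/-! Reach probabilities and sequence form -/

/-- The parent sequence `σ(s)`; `none` is the empty sequence. -/
def Game.parentSeq (G : Game S A C) (s : S) : Option (Σ s, A s) := (G.personal s).head?

open Classical in
/-- The nodes of an infoset. -/
def Game.infoNodes (G : Game S A C) (s : S) : Finset (Hist S A C) :=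
  G.nodes.filter fun h => G.turn h = .infoset s

/-- `μ_c(h)`, the contribution of chance to the probability of reaching `h`. -/
def Game.chanceReach (G : Game S A C) : Hist S A C → ℝ
  | [] => 1
  | .chance c :: h => G.chanceProb h c * G.chanceReach h
  | .act _ _ :: h => G.chanceReach h

/-- `μ_i(σ_i(h))`, the contribution of player `i` to the probability of reaching `h`. -/
def Game.playerReach (G : Game S A C) (π : Profile S A) (i : Fin 2) (h : Hist S A C) : ℝ :=
  ((personalMoves G.player i h).map fun p => π p.1 p.2).prod

/-- The probability of reaching `h`. -/
def Game.reach (G : Game S A C) (π : Profile S A) (h : Hist S A C) : ℝ :=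
  G.chanceReach h * G.playerReach π 0 h * G.playerReach π 1 h

/-- `μ^π(σ(s))`, the contribution of the acting player to the probability of reaching `s`. -/
def Game.ownReach (G : Game S A C) (π : Profile S A) (s : S) : ℝ :=
  ((G.personal s).map fun p => π p.1 p.2).prod

/-- `μ_{-p(s)}(s)`, the contribution of the opponent and of chance to the probability of
reaching `s`. -/
def Game.oppReach (G : Game S A C) (π : Profile S A) (s : S) : ℝ :=
  ∑ h ∈ G.infoNodes s, G.chanceReach h * G.playerReach π (1 - G.player s) h

/-- `∑_{h ∈ s} μ_c(h)`. -/
def Game.chanceMass (G : Game S A C) (s : S) : ℝ := ∑ h ∈ G.infoNodes s, G.chanceReach h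

/-- The sequence-form vector `μ^π` of both players: `μ(s,a) = μ(σ(s)) π(a|s)`. -/
def Game.seqForm (G : Game S A C) (π : Profile S A) : (Σ s, A s) → ℝ :=
  fun p => G.ownReach π p.1 * π p.1 p.2

/-- The entry of a sequence-form vector at `σ(s)`; it is `1` at the empty sequence. -/
def Game.atParent (G : Game S A C) (x : (Σ s, A s) → ℝ) (s : S) : ℝ :=
  match G.parentSeq s with
  | none => 1
  | some p => x p

/-- The dilated regularizer `ψ^Π = ψ^{Π_1} + ψ^{Π_2}`, a function of sequence-form vectors. -/
def Game.dilated (G : Game S A C) (P : Params S A) (x : (Σ s, A s) → ℝ) : ℝ :=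
  ∑ s, G.atParent x s * P.psi s (fun a => x ⟨s, a⟩ / G.atParent x s)

/-! The regularized and perturbed game -/

open Classical in
/-- Expected utility of player 1. -/
def Game.utility (G : Game S A C) (π : Profile S A) : ℝ :=
  ∑ z ∈ G.nodes.filter (fun h => G.turn h = .terminal), G.reach π z * G.payoff z

/-- The bidilated regularizer of player `i`. -/
def Game.bidilated (G : Game S A C) (P : Params S A) (i : Fin 2) (π : Profile S A) : ℝ :=
  ∑ s, if G.player s = i then G.ownReach π s * G.oppReach π s * P.psi s (π s) else 0

/-- The objective of the regularized game; player 1 maximizes it, player 2 minimizes it. -/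
def Game.objective (G : Game S A C) (P : Params S A) (π : Profile S A) : ℝ :=
  G.utility π - P.τ * G.bidilated P 0 π + P.τ * G.bidilated P 1 π

/-- The profile in which player 1 follows `π` and player 2 follows `π'`. -/
def Game.combine (G : Game S A C) (π π' : Profile S A) : Profile S A :=
  fun s => if G.player s = 0 then π s else π' s

/-- `π` is a Nash equilibrium (saddle point) of the regularized and perturbed game. -/
def Game.IsRegularizedNash (G : Game S A C) (P : Params S A) (π : Profile S A) : Prop :=
  P.Feasible π ∧
    (∀ π', P.Feasible π' → G.objective P (G.combine π' π) ≤ G.objective P π) ∧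
    (∀ π', P.Feasible π' → G.objective P π ≤ G.objective P (G.combine π π'))

/-! Feedback -/

/-- The reward that player `i` collects at the node `h` of the regularized game: the utility at a
terminal node, minus `τ ψ_s^Δ` at a node of an own infoset `s`, plus `τ ψ_s^Δ` at a node of an
infoset `s` of the opponent. -/
def Game.nodeReward (G : Game S A C) (P : Params S A) (π : Profile S A) (i : Fin 2)
    (h : Hist S A C) : ℝ :=
  match G.turn h with
  | .terminal => if i = 0 then G.payoff h else -G.payoff h
  | .chance => 0
  | .infoset s => if G.player s = i then -(P.τ * P.psi s (π s)) else P.τ * P.psi s (π s)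

open Classical in
/-- The nodes `h'` with `(h, a) ⊑ h'` for some node `h` of `s`. -/
def Game.below (G : Game S A C) (s : S) (a : A s) : Finset (Hist S A C) :=
  G.nodes.filter fun h' => ∃ h ∈ G.infoNodes s, Move.act s a :: h <:+ h'

/-- Trajectory Q-value (of the acting player). -/
def Game.trajQ (G : Game S A C) (P : Params S A) (π : Profile S A) (s : S) (a : A s) : ℝ :=
  1 / π s a * ∑ h' ∈ G.below s a, G.reach π h' * G.nodeReward P π (G.player s) h'

/-- Q-value (of the acting player). -/
def Game.condQ (G : Game S A C) (P : Params S A) (π : Profile S A) (s : S) (a : A s) : ℝ :=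
  G.trajQ P π s a / ∑ h ∈ G.infoNodes s, G.reach π h

/-- Counterfactual value (of the acting player). -/
def Game.cfValue (G : Game S A C) (P : Params S A) (π : Profile S A) (s : S) (a : A s) : ℝ :=
  ∑ h' ∈ G.below s a, G.chanceReach h' *
    (G.playerReach π (G.player s) h' / G.seqForm π ⟨s, a⟩) *
    G.playerReach π (1 - G.player s) h' * G.nodeReward P π (G.player s) h'

/-- The feedback `q(s, a)`. -/
def Game.feedback (G : Game S A C) (P : Params S A) (f : Feedback) (π : Profile S A) :
    Profile S A := fun s a =>
  match f with
  | .counterfactual => G.cfValue P π s a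
  | .trajectoryQ => G.trajQ P π s a
  | .qValue => G.condQ P π s a

/-- The factor `m_s` with (counterfactual value) = `m_s` · (feedback). -/
def Game.weight (G : Game S A C) (f : Feedback) (π : Profile S A) (s : S) : ℝ :=
  match f with
  | .counterfactual => 1
  | .trajectoryQ => 1 / G.ownReach π s
  | .qValue => G.oppReach π s

/-! The algorithm -/

/-- The function minimized in one step at the infoset `s`, with feedback `q`, regularization
weights taken from the profile `π`, learning rate `η` and prox center `y`. -/
def Game.stepObjective (G : Game S A C) (P : Params S A) (f : Feedback) (η : ℝ) (s : S)
    (q : A s → ℝ) (π : Profile S A) (y u : A s → ℝ) : ℝ :=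
  ∑ a, u a * (-q a) + P.τ * G.oppReach π s / G.weight f π s * P.psi s u
    + 1 / η * bregman (P.psi s) u y

/-- `x` is a minimizer of `F` on `K`. -/
def IsArgmin {E : Type*} (F : E → ℝ) (K : Set E) (x : E) : Prop := x ∈ K ∧ IsMinOn F K x

/-- A run of the update rule with learning rates `η`. The rule at `t = 1` reads data with index
`0`: there `π 0 = πbar 1`, and `q 0` is zero or the feedback at `π 0`. (With `q 0 = 0` and uniform
`πbar 1` this gives `π 1 = πbar 1` uniform.) -/
structure IsRun (G : Game S A C) (P : Params S A) (f : Feedback) (η : S → ℝ)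
    (π πbar : ℕ → Profile S A) (q : ℕ → Profile S A) : Prop where
  init_feasible : P.Feasible (πbar 1)
  init : π 0 = πbar 1
  init_feedback : q 0 = 0 ∨ q 0 = G.feedback P f (π 0)
  feedback_eq : ∀ t, 1 ≤ t → q t = G.feedback P f (π t)
  step : ∀ t, 1 ≤ t → ∀ s, IsArgmin
    (G.stepObjective P f (η s) s (q (t - 1) s) (π (t - 1)) (πbar t s))
    (P.perturbedSimplex s) (π t s)
  step_bar : ∀ t, 1 ≤ t → ∀ s, IsArgmin
    (G.stepObjective P f (η s) s (q t s) (π t) (πbar t s))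
    (P.perturbedSimplex s) (πbar (t + 1) s)

/-- `‖q‖_∞`, the largest absolute value of the feedback up to time `T`. -/
def feedbackBound (q : ℕ → Profile S A) (T : ℕ) : ℝ :=
  ⨆ x : Fin (T + 1) × (Σ s, A s), |q x.1 x.2.1 x.2.2|

/-- `γ` is a positive lower bound of all sequence-form probabilities in the perturbed game. -/
def Game.IsReachBound (G : Game S A C) (P : Params S A) (γ : ℝ) : Prop :=
  0 < γ ∧ ∀ π, P.Feasible π → ∀ p, γ ≤ G.seqForm π p

/-! Constants; `Q` stands for `‖q‖_∞`. -/

/-- Lower bound `M_1` of the factors `m_s`. -/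
def Game.M1 (G : Game S A C) (f : Feedback) (γ : ℝ) : ℝ :=
  match f with
  | .counterfactual => 1
  | .trajectoryQ => 1
  | .qValue => γ * ⨅ s, G.chanceMass s

/-- Upper bound `M_2` of the factors `m_s`. -/
def M2 (f : Feedback) (γ : ℝ) : ℝ :=
  match f with
  | .counterfactual => 1
  | .trajectoryQ => 1 / γ
  | .qValue => 1

/-- `C_s^diff`. -/
def Game.cDiff (G : Game S A C) (P : Params S A) (f : Feedback) (γ Q : ℝ) (s : S) : ℝ :=
  match P.reg with
  | .entropy => 2 / P.α s * (Q + P.τ * P.α s / G.M1 f γ * Real.log (1 / γ))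
  | .euclidean => Fintype.card (A s) / P.α s * Q + P.τ / G.M1 f γ * √(Fintype.card (A s))

/-- `max_s (2 ‖q‖_∞ / α_s + (τ / M_1) log (1/γ))`. -/
def Game.cEnt (G : Game S A C) (P : Params S A) (f : Feedback) (γ Q : ℝ) : ℝ :=
  ⨆ s, (2 * Q / P.α s + P.τ / G.M1 f γ * Real.log (1 / γ))

/-- The additive stability constant `C_s^-` of the factors `m_s` that belong to the feedback
type `f'`, when the algorithm runs with feedback type `f`. -/
def Game.cMinus (G : Game S A C) (P : Params S A) (f : Feedback) (γ Q : ℝ) (f' : Feedback)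
    (s : S) : ℝ :=
  match f', P.reg with
  | .counterfactual, _ => 0
  | .trajectoryQ, .euclidean => 6 / γ ^ 2 * ⨆ s', G.cDiff P f γ Q s'
  | .trajectoryQ, .entropy => 12 * G.cEnt P f γ Q / γ
  | .qValue, .euclidean => 6 * (G.infoNodes s).card * ⨆ s', G.cDiff P f γ Q s'
  | .qValue, .entropy => 12 * G.cEnt P f γ Q

/-- The multiplicative stability constant `C_s^/`. -/
def Game.cSlash (G : Game S A C) (P : Params S A) (f : Feedback) (γ Q : ℝ) (s : S) : ℝ :=
  match f, P.reg with
  | .counterfactual, _ => 0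
  | .trajectoryQ, .euclidean => 6 / (γ ^ 2 * G.M1 f γ) * ⨆ s', G.cDiff P f γ Q s'
  | .trajectoryQ, .entropy => 12 * G.cEnt P f γ Q
  | .qValue, .euclidean => 6 * (G.infoNodes s).card / G.M1 f γ * ⨆ s', G.cDiff P f γ Q s'
  | .qValue, .entropy => 12 * G.cEnt P f γ Q

/-! Learning rates -/

/-- `s'` is an infoset (of either player) on the path to some node of `s`. -/
def Game.IsAncestor (G : Game S A C) (s' s : S) : Prop :=
  ∃ h ∈ G.infoNodes s, ∃ a, Move.act s' a ∈ h

/-- `η_s^anc`, the largest learning rate among the ancestors of `s` (zero if there are none). -/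
def Game.ancRate (G : Game S A C) (η : S → ℝ) (s : S) : ℝ :=
  ⨆ s' : {s' // G.IsAncestor s' s}, η s'

/-- The conditions on the learning rates. -/
structure RateConditions (G : Game S A C) (P : Params S A) (f : Feedback) (γ Q : ℝ)
    (η : S → ℝ) : Prop where
  pos : ∀ s, 0 < η s
  /-- `η_s^anc / η_s ≤ τ C_s^η` with `C_s^η = γ / (2 C_s^-) ∑_{h ∈ s} μ_c(h)`, multiplied by
  `C_s^-` so that it is no condition where `C_s^- = 0` -/
  ratio : ∀ s, G.cMinus P f γ Q f s * (G.ancRate η s / η s) ≤ P.τ * (γ / 2 * G.chanceMass s)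
  condA : ∀ s, ∀ i : Fin 2, ∀ h ∈ G.infoNodes s,
    ((personalMoves G.player i h).map fun p => η p.1).sum ≤ η s
  condB : ∀ s, 6 * G.ancRate η s * G.cEnt P f γ Q ≤ 1
  condC : ∀ s, η s * (2 * Q + P.τ * P.α s / G.M1 f γ * Real.log (1 / γ)) ≤ 1

/-- `D_{ψ^Π}(μ^π, μ^{π'})`, the Bregman divergence of the dilated regularizer. -/
def Game.divergence (G : Game S A C) (P : Params S A) (π π' : Profile S A) : ℝ :=
  bregman (G.dilated P) (G.seqForm π) (G.seqForm π')

/-- The explicit upper bound on the cumulative divergence. -/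
def Game.explicitBound (G : Game S A C) (P : Params S A) (f : Feedback) (γ : ℝ) (η : S → ℝ)
    (π πbar q : ℕ → Profile S A) (πstar : Profile S A) (T : ℕ) : ℝ :=
  2 / (γ * ⨅ s, G.chanceMass s) *
      ∑ s, (G.cSlash P f γ (feedbackBound q T) s + G.cMinus P f γ (feedbackBound q T) .qValue s) *
        G.ancRate η s * G.ownReach πstar s *
        ∑ t ∈ Finset.Icc 1 T, |P.psi s (π t s) - P.psi s (πbar (t + 1) s)|
    + 4 / (P.τ * γ * ⨅ s, G.chanceMass s) *
      ∑ s, G.cDiff P f γ (feedbackBound q T) s * G.ownReach πstar s * feedbackBound q T *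
        η s * M2 f γ * T
    + 2 / (P.τ * γ * ⨅ s, G.chanceMass s) *
      ∑ s, G.weight f (π 1) s / η s * G.ownReach πstar s *
        bregman (P.psi s) (πstar s) (πbar 1 s)

end

end EFG

end

/-!
The run is an optimistic mirror descent with one proximal step per infoset, and the theorem is a
regret bound read backwards. The local regret of `π^t` against the equilibrium strategy `π*` at an
infoset (`Game.localRegret`) is measured in counterfactual values, of which all three feedback types
are rescalings by the factors `m_s`. Summed over the infosets with the reach probabilities of `π*`,
the local regrets are the gains of the two players from deviating to `π*`
(`Game.value_sub`, a telescoping of the reach probabilities along the path to each node), and their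
total is non-negative because `π*` is a saddle point
(`Game.IsRegularizedNash.sum_localRegret_nonneg`).

From above, the three-point inequality of the proximal steps (`Params.prox_three_point`, applied to
both steps of a round) bounds the local regret by a difference of consecutive divergences from `π*`,
minus a gain `τ μ_{-p(s)}(s) D(π*, πbar^{t+1})` from the regularizer, plus two errors
(`IsRun.localRegret_le`): the gap between anticipated and received feedback, absorbed by Young's
inequality, and the change of the weight of the regularizer between the two steps of a round. The
sum over `t` telescopes up to the change of the factors `m_s`, for which half of the gain pays
(`IsRun.weight_div_add_le`). What remains of the gain is the cumulative divergence, by the formula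
`Game.divergence_eq` for the dilated regularizer.

Both changes are controlled by stability of the iterates. Moving mass from an action that has gained
mass to another one keeps a strategy feasible, so first-order optimality bounds the movement of a
single step (`Params.prox_exchange`); consecutive iterates are at most three steps apart, and the
rates on a path add up to at most twice the largest ancestor rate (`RateConditions.sum_path_le`).
Perfect recall is also what bounds `μ_{-p(s)}(s)` by one (`Game.oppReach_le_one`).

For the constants of the last two claims, the feedback is bounded uniformly over all feasible
profiles, and the explicit bound is monotone in that bound.
-/

set_option linter.unusedSectionVars false

namespace EFG

/-! ### One proximal step on the perturbed simplex -/

theorem IsArgmin.fderiv_nonneg {E : Type*} [NormedAddCommGroup E] [NormedSpace ℝ E] {F : E → ℝ}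
    {F' : E →L[ℝ] ℝ} {K : Set E} {x y : E} (hK : Convex ℝ K) (h : IsArgmin F K x)
    (hF : HasFDerivAt F F' x) (hy : y ∈ K) : 0 ≤ F' (y - x) :=
  h.2.localize.hasFDerivWithinAt_nonneg hF.hasFDerivWithinAt
    (sub_mem_posTangentConeAt_of_segment_subset (hK.segment_subset h.1 hy))

/-- The linear functional `v ↦ ∑ a, g a * v a`. -/
noncomputable def dotCLM {ι : Type*} [Fintype ι] (g : ι → ℝ) : (ι → ℝ) →L[ℝ] ℝ :=
  ∑ a, g a • ContinuousLinearMap.proj (R := ℝ) (φ := fun _ : ι => ℝ) a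

@[simp] theorem dotCLM_apply {ι : Type*} [Fintype ι] (g v : ι → ℝ) :
    dotCLM g v = ∑ a, g a * v a := by
  simp [dotCLM]

section
variable {S : Type*} {A : S → Type*} [∀ s, Fintype (A s)] {P : Params S A} {s : S}

/-- The gradient of the regularizer `ψ_s` at a positive vector. -/
noncomputable def Params.gradPsi (P : Params S A) (s : S) (u : A s → ℝ) : A s → ℝ := fun a =>
  match P.reg with
  | .entropy => P.α s * (Real.log (u a) + 1)
  | .euclidean => P.α s * u a

theorem Params.hasFDerivAt_psi {u : A s → ℝ} (hu : ∀ a, 0 < u a) :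
    HasFDerivAt (P.psi s) (dotCLM (P.gradPsi s u)) u := by
  have hp : ∀ a : A s, HasFDerivAt (fun v : A s → ℝ => v a)
      (ContinuousLinearMap.proj (R := ℝ) (φ := fun _ : A s => ℝ) a) u :=
    fun a => hasFDerivAt_apply a u
  rcases hr : P.reg with _ | _
  · have h1 : ∀ a : A s, HasFDerivAt (fun v : A s → ℝ => v a * Real.log (v a))
        ((Real.log (u a) + 1) • ContinuousLinearMap.proj (R := ℝ) (φ := fun _ : A s => ℝ) a) u :=
      fun a => HasDerivAt.comp_hasFDerivAt (h₂ := fun x => x * Real.log x) u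
        (Real.hasDerivAt_mul_log (hu a).ne') (hp a)
    have h2 := ((HasFDerivAt.fun_sum (u := Finset.univ) fun a _ => h1 a).const_add
      (Real.log (Fintype.card (A s)))).const_mul (P.α s)
    have h3 : P.psi s = fun v : A s → ℝ =>
        P.α s * (Real.log (Fintype.card (A s)) + ∑ a, v a * Real.log (v a)) := by
      funext v; simp [Params.psi, hr]
    rw [h3]
    refine h2.congr_fderiv (ContinuousLinearMap.ext fun v => ?_)
    simp [Params.gradPsi, hr, Finset.mul_sum, mul_assoc]
  · have h2 := (HasFDerivAt.fun_sum (u := Finset.univ) fun a _ => (hp a).pow 2).const_mul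
      (P.α s / 2)
    have h3 : P.psi s = fun v : A s → ℝ => P.α s / 2 * ∑ a, v a ^ 2 := by
      funext v; simp [Params.psi, hr]
    rw [h3]
    refine h2.congr_fderiv (ContinuousLinearMap.ext fun v => ?_)
    simp only [Params.gradPsi, hr, dotCLM_apply]
    simp [Finset.mul_sum]
    refine Finset.sum_congr rfl fun a _ => by ring

theorem Params.bregman_psi_eq {x y : A s → ℝ} (hy : ∀ a, 0 < y a) :
    bregman (P.psi s) x y = P.psi s x - P.psi s y - ∑ a, P.gradPsi s y a * (x a - y a) := by
  simp [bregman, (P.hasFDerivAt_psi hy).fderiv]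

theorem Params.bregman_entropy (hr : P.reg = .entropy) {x y : A s → ℝ} (hy : ∀ a, 0 < y a) :
    bregman (P.psi s) x y =
      P.α s * ∑ a, (x a * (Real.log (x a) - Real.log (y a)) - x a + y a) := by
  rw [P.bregman_psi_eq hy]
  simp only [Params.psi, Params.gradPsi, hr]
  have e : ∑ a, (x a * (Real.log (x a) - Real.log (y a)) - x a + y a) =
      ∑ a, x a * Real.log (x a) - ∑ a, y a * Real.log (y a) -
        ∑ a, (Real.log (y a) + 1) * (x a - y a) := by
    rw [← Finset.sum_sub_distrib, ← Finset.sum_sub_distrib]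
    exact Finset.sum_congr rfl fun a _ => by ring
  rw [e]
  simp only [mul_assoc, ← Finset.mul_sum]
  ring

theorem Params.bregman_euclidean (hr : P.reg = .euclidean) {x y : A s → ℝ} (hy : ∀ a, 0 < y a) :
    bregman (P.psi s) x y = P.α s / 2 * ∑ a, (x a - y a) ^ 2 := by
  rw [P.bregman_psi_eq hy]
  simp only [Params.psi, Params.gradPsi, hr, Finset.mul_sum, ← Finset.sum_sub_distrib]
  exact Finset.sum_congr rfl fun a _ => by ring

/-- Relative entropy dominates the squared Hellinger distance, coordinate by coordinate. -/
theorem hellinger_le {p q : ℝ} (hp : 0 < p) (hq : 0 < q) :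
    (√p - √q) ^ 2 ≤ p * (Real.log p - Real.log q) - p + q := by
  have hp' := Real.sqrt_pos.2 hp
  have hq' := Real.sqrt_pos.2 hq
  have h := Real.log_le_sub_one_of_pos (div_pos hq' hp')
  rw [Real.log_div hq'.ne' hp'.ne', Real.log_sqrt hp.le, Real.log_sqrt hq.le] at h
  have e1 := Real.sq_sqrt hp.le
  have e2 := Real.sq_sqrt hq.le
  have h' := mul_le_mul_of_nonneg_left h hp.le
  have e3 : p * (√q / √p - 1) = √p * √q - p := by
    rw [mul_sub, mul_one, ← mul_div_assoc]
    nth_rw 1 [← e1]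
    field_simp
  rw [e3] at h'
  nlinarith

theorem Params.bregman_nonneg {x y : A s → ℝ} (hx : ∀ a, 0 < x a) (hy : ∀ a, 0 < y a) :
    0 ≤ bregman (P.psi s) x y := by
  have hα := P.α_pos s
  rcases hr : P.reg with _ | _
  · rw [P.bregman_entropy hr hy]
    exact mul_nonneg hα.le (Finset.sum_nonneg fun a _ =>
      (sq_nonneg _).trans (hellinger_le (hx a) (hy a)))
  · rw [P.bregman_euclidean hr hy]
    positivity

/-- Young's inequality for the entropy: the change of the strategy against a bounded vector is
absorbed by the divergence. -/
theorem Params.sum_sub_mul_le_entropy (hr : P.reg = .entropy) {x y d : A s → ℝ} {Q η : ℝ}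
    (hη : 0 < η) (hx : ∀ a, 0 < x a) (hy : ∀ a, 0 < y a) (hx1 : ∑ a, x a = 1)
    (hy1 : ∑ a, y a = 1) (hd : ∀ a, |d a| ≤ 2 * Q) :
    ∑ a, (x a - y a) * d a - 1 / η * bregman (P.psi s) x y ≤ 4 * Q ^ 2 * η / P.α s := by
  have hα := P.α_pos s
  rw [P.bregman_entropy hr hy, ← mul_assoc, Finset.mul_sum, ← Finset.sum_sub_distrib]
  have key : ∀ a, (x a - y a) * d a -
      1 / η * P.α s * (x a * (Real.log (x a) - Real.log (y a)) - x a + y a) ≤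
      2 * Q ^ 2 * η / P.α s * (x a + y a) := by
    intro a
    have h1 := mul_le_mul_of_nonneg_left (hellinger_le (hx a) (hy a))
      (show 0 ≤ 1 / η * P.α s by positivity)
    have e1 := Real.sq_sqrt (hx a).le
    have e2 := Real.sq_sqrt (hy a).le
    set p := √(x a)
    set q := √(y a)
    have hd2 : d a ^ 2 ≤ 4 * Q ^ 2 := by
      have := sq_le_sq' (by linarith [abs_nonneg (d a), hd a]) (hd a)
      rw [sq_abs] at this; linarith
    -- complete the square in `p - q`, against `(p + q) d`
    have h2 : (p - q) * ((p + q) * d a) ≤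
        1 / η * P.α s * (p - q) ^ 2 + η / (4 * P.α s) * ((p + q) * d a) ^ 2 := by
      have : 0 ≤ 1 / η * P.α s * ((p - q) - η / (2 * P.α s) * ((p + q) * d a)) ^ 2 := by positivity
      have e : 1 / η * P.α s * ((p - q) - η / (2 * P.α s) * ((p + q) * d a)) ^ 2 =
        1 / η * P.α s * (p - q) ^ 2 + η / (4 * P.α s) * ((p + q) * d a) ^ 2 -
          (p - q) * ((p + q) * d a) := by field_simp; ring
      linarith
    have h3 : η / (4 * P.α s) * ((p + q) * d a) ^ 2 ≤ 2 * Q ^ 2 * η / P.α s * (x a + y a) := by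
      have h4 : ((p + q) * d a) ^ 2 ≤ (2 * (p ^ 2 + q ^ 2)) * (4 * Q ^ 2) := by
        rw [mul_pow]
        exact mul_le_mul (by nlinarith [sq_nonneg (p - q)]) hd2 (sq_nonneg _) (by positivity)
      calc _ ≤ η / (4 * P.α s) * ((2 * (p ^ 2 + q ^ 2)) * (4 * Q ^ 2)) :=
            mul_le_mul_of_nonneg_left h4 (by positivity)
        _ = _ := by rw [e1, e2]; field_simp
    have e3 : (x a - y a) * d a = (p - q) * ((p + q) * d a) := by rw [← e1, ← e2]; ring
    linarith
  calc _ ≤ ∑ a, 2 * Q ^ 2 * η / P.α s * (x a + y a) := Finset.sum_le_sum fun a _ => key a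
    _ = _ := by rw [← Finset.mul_sum, Finset.sum_add_distrib, hx1, hy1]; ring

/-- Young's inequality for the Euclidean regularizer. -/
theorem Params.sum_sub_mul_le_euclidean (hr : P.reg = .euclidean) {x y d : A s → ℝ} {Q η : ℝ}
    (hη : 0 < η) (hy : ∀ a, 0 < y a) (hd : ∀ a, |d a| ≤ 2 * Q) :
    ∑ a, (x a - y a) * d a - 1 / η * bregman (P.psi s) x y ≤
      2 * Fintype.card (A s) * Q ^ 2 * η / P.α s := by
  have hα := P.α_pos s
  rw [P.bregman_euclidean hr hy, ← mul_assoc, Finset.mul_sum, ← Finset.sum_sub_distrib]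
  have key : ∀ a, (x a - y a) * d a - 1 / η * (P.α s / 2) * (x a - y a) ^ 2 ≤
      2 * Q ^ 2 * η / P.α s := by
    intro a
    have hd2 : d a ^ 2 ≤ 4 * Q ^ 2 := by
      have := sq_le_sq' (by linarith [abs_nonneg (d a), hd a]) (hd a)
      rw [sq_abs] at this; linarith
    have h1 : 0 ≤ 1 / η * (P.α s / 2) * ((x a - y a) - η / P.α s * d a) ^ 2 := by positivity
    have e : 1 / η * (P.α s / 2) * ((x a - y a) - η / P.α s * d a) ^ 2 =
        1 / η * (P.α s / 2) * (x a - y a) ^ 2 + η / (2 * P.α s) * d a ^ 2 -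
          (x a - y a) * d a := by field_simp; ring
    have h2 : η / (2 * P.α s) * d a ^ 2 ≤ η / (2 * P.α s) * (4 * Q ^ 2) :=
      mul_le_mul_of_nonneg_left hd2 (by positivity)
    have e2 : η / (2 * P.α s) * (4 * Q ^ 2) = 2 * Q ^ 2 * η / P.α s := by field_simp; ring
    linarith
  calc _ ≤ ∑ _a : A s, 2 * Q ^ 2 * η / P.α s := Finset.sum_le_sum fun a _ => key a
    _ = _ := by simp; ring

theorem Params.convex_perturbedSimplex : Convex ℝ (P.perturbedSimplex s) := by
  intro x hx y hy a b ha hb hab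
  refine ⟨convex_stdSimplex ℝ (A s) hx.1 hy.1 ha hb hab, fun c => ?_⟩
  have h1 := mul_le_mul_of_nonneg_left (hx.2 c) ha
  have h2 := mul_le_mul_of_nonneg_left (hy.2 c) hb
  simp only [Pi.add_apply, Pi.smul_apply, smul_eq_mul]
  calc _ = a * (P.expl s * P.ν s c) + b * (P.expl s * P.ν s c) := by rw [← add_mul, hab, one_mul]
    _ ≤ _ := add_le_add h1 h2

theorem Params.pos_of_mem {u : A s → ℝ} (hu : u ∈ P.perturbedSimplex s) (a : A s) : 0 < u a :=
  (mul_pos (P.expl_mem s).1 (P.ν_pos s a)).trans_le (hu.2 a)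

/-- The objective of a proximal step with linear part `-q`, weight `c` of the regularizer,
learning rate `η` and center `y`. -/
noncomputable def Params.proxObjective (P : Params S A) (s : S) (c η : ℝ) (q y u : A s → ℝ) : ℝ :=
  ∑ a, u a * (-q a) + c * P.psi s u + 1 / η * bregman (P.psi s) u y

variable {c η : ℝ} {q y u v : A s → ℝ}

/-- The first-order optimality condition of a proximal step. -/
theorem Params.prox_variational
    (h : IsArgmin (P.proxObjective s c η q y) (P.perturbedSimplex s) u)
    (hy : ∀ a, 0 < y a) (hv : v ∈ P.perturbedSimplex s) :
    0 ≤ ∑ a, (-q a + c * P.gradPsi s u a + 1 / η * (P.gradPsi s u a - P.gradPsi s y a)) *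
      (v a - u a) := by
  have hu : ∀ a, 0 < u a := P.pos_of_mem h.1
  have h1 := P.hasFDerivAt_psi hu
  have h2 : HasFDerivAt (fun u : A s → ℝ => ∑ a, u a * (-q a)) (dotCLM fun a => -q a) u := by
    have := (dotCLM fun a => -q a).hasFDerivAt (x := u)
    convert this using 1
    funext w
    simp [mul_comm]
  have h3 : HasFDerivAt (fun u : A s → ℝ => bregman (P.psi s) u y)
      (dotCLM (P.gradPsi s u) - fderiv ℝ (P.psi s) y) u := by
    have h4 : HasFDerivAt (fun u : A s → ℝ => fderiv ℝ (P.psi s) y (u - y))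
        (fderiv ℝ (P.psi s) y) u := by
      exact (fderiv ℝ (P.psi s) y).hasFDerivAt.comp u ((hasFDerivAt_id u).sub_const y)
    exact (h1.sub_const _).sub h4
  have h5 : HasFDerivAt (P.proxObjective s c η q y) _ u :=
    (h2.add (h1.const_mul c)).add (h3.const_mul (1 / η))
  have h6 := h.fderiv_nonneg P.convex_perturbedSimplex h5 hv
  rw [(P.hasFDerivAt_psi hy).fderiv] at h6
  refine h6.trans_eq ?_
  simp only [add_apply, smul_apply, dotCLM_apply,
    sub_apply, smul_eq_mul, Finset.mul_sum, ← Finset.sum_add_distrib,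
    ← Finset.sum_sub_distrib, Pi.sub_apply]
  exact Finset.sum_congr rfl fun a _ => by ring

/-- The three-point inequality of a proximal step. -/
theorem Params.prox_three_point
    (h : IsArgmin (P.proxObjective s c η q y) (P.perturbedSimplex s) u)
    (hy : ∀ a, 0 < y a) (hv : v ∈ P.perturbedSimplex s) :
    ∑ a, (v a - u a) * q a + c * (P.psi s u - P.psi s v) ≤
      1 / η * (bregman (P.psi s) v y - bregman (P.psi s) u y) -
        (c + 1 / η) * bregman (P.psi s) v u := by
  have hu : ∀ a, 0 < u a := P.pos_of_mem h.1
  have h1 := P.prox_variational h hy hv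
  rw [P.bregman_psi_eq hy, P.bregman_psi_eq hy, P.bregman_psi_eq hu]
  have e1 : ∑ a, (-q a + c * P.gradPsi s u a + 1 / η * (P.gradPsi s u a - P.gradPsi s y a)) *
      (v a - u a) = -∑ a, (v a - u a) * q a + (c + 1 / η) * ∑ a, P.gradPsi s u a * (v a - u a) -
        1 / η * (∑ a, P.gradPsi s y a * (v a - y a) - ∑ a, P.gradPsi s y a * (u a - y a)) := by
    rw [← Finset.sum_sub_distrib]
    simp only [Finset.mul_sum, ← Finset.sum_neg_distrib, ← Finset.sum_add_distrib,
      ← Finset.sum_sub_distrib]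
    exact Finset.sum_congr rfl fun a _ => by ring
  rw [e1] at h1
  linarith

/-- Moving mass from an action `a` that has gained mass to any other action `b` stays inside the
perturbed simplex, so it cannot decrease the objective to first order. -/
theorem Params.prox_exchange
    (h : IsArgmin (P.proxObjective s c η q y) (P.perturbedSimplex s) u)
    (hy : y ∈ P.perturbedSimplex s) {a : A s} (ha : y a < u a) (b : A s) :
    -q a + c * P.gradPsi s u a + 1 / η * (P.gradPsi s u a - P.gradPsi s y a) ≤
      -q b + c * P.gradPsi s u b + 1 / η * (P.gradPsi s u b - P.gradPsi s y b) := by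
  classical
  rcases eq_or_ne a b with rfl | hab
  · exact le_rfl
  set δ := u a - y a with hδ
  have hδ0 : 0 < δ := sub_pos.2 ha
  set v : A s → ℝ := u + (Pi.single b δ - Pi.single a δ) with hv
  have hva : ∀ x, v x - u x = (if x = b then δ else 0) - (if x = a then δ else 0) := by
    intro x; simp [hv, Pi.single_apply]
  have hvK : v ∈ P.perturbedSimplex s := by
    have hlow : ∀ x, P.expl s * P.ν s x ≤ v x := by
      intro x
      have h1 := hva x
      have h2 := h.1.2 x
      by_cases hxa : x = a
      · subst hxa
        have := hy.2 x
        simp [hab] at h1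
        linarith
      · simp only [hxa, if_false, sub_zero] at h1
        split_ifs at h1 <;> linarith
    refine ⟨⟨fun x => (mul_pos (P.expl_mem s).1 (P.ν_pos s x)).le.trans (hlow x), ?_⟩, hlow⟩
    have : ∑ x, (v x - u x) = 0 := by simp [hva, Finset.sum_sub_distrib]
    rw [Finset.sum_sub_distrib, h.1.1.2] at this
    linarith
  have h1 := P.prox_variational h (P.pos_of_mem hy) hvK
  simp only [hva, mul_sub, Finset.sum_sub_distrib, mul_ite, mul_zero, Finset.sum_ite_eq',
    Finset.mem_univ, if_true, ← sub_mul] at h1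
  have := nonneg_of_mul_nonneg_left h1 hδ0
  linarith

/-- If whenever one coordinate grows the other coordinates cannot fall behind it by more than
`ε`, then no coordinate moves by more than `ε`; here `φ` is the scale on which the
movement is measured. -/
theorem abs_sub_le_of_exchange {φ : ℝ → ℝ} {ε : ℝ} (hφ : StrictMonoOn φ (Set.Ioi 0))
    (hu : ∀ a, 0 < u a) (hy : ∀ a, 0 < y a) (hε : 0 ≤ ε) (hsum : ∑ a, u a = ∑ a, y a)
    (hex : ∀ a, y a < u a → ∀ b, φ (u a) - φ (y a) - (φ (u b) - φ (y b)) ≤ ε) (a : A s) :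
    |φ (u a) - φ (y a)| ≤ ε := by
  rw [abs_le]
  constructor
  · by_contra! hlt
    have h1 : u a < y a := by
      have : φ (u a) < φ (y a) := by linarith
      exact (hφ.lt_iff_lt (hu a) (hy a)).1 this
    obtain ⟨b, -, hb⟩ : ∃ b ∈ Finset.univ, y b < u b := by
      by_contra! hall
      exact absurd hsum (Finset.sum_lt_sum hall ⟨a, Finset.mem_univ _, h1⟩).ne
    have := hex b hb a
    have := hφ (hy b) (hu b) hb
    linarith
  · rcases le_or_gt (u a) (y a) with h1 | h1
    · have := (hφ.le_iff_le (hu a) (hy a)).2 h1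
      linarith
    · obtain ⟨b, -, hb⟩ : ∃ b ∈ Finset.univ, u b < y b := by
        by_contra! hall
        exact absurd hsum (Finset.sum_lt_sum hall ⟨a, Finset.mem_univ _, h1⟩).ne'
      have := hex a h1 b
      have := hφ (hu b) (hy b) hb
      linarith

theorem Params.prox_stable_entropy (hr : P.reg = .entropy)
    (h : IsArgmin (P.proxObjective s c η q y) (P.perturbedSimplex s) u)
    (hy : y ∈ P.perturbedSimplex s) {Q γ : ℝ} (hη : 0 < η) (hc : 0 ≤ c) (hq : ∀ a, |q a| ≤ Q)
    (hγ : 0 < γ) (hγ1 : γ ≤ 1) (hγu : ∀ a, γ ≤ u a) (a : A s) :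
    |Real.log (u a) - Real.log (y a)| ≤ η * (2 * Q / P.α s + c * Real.log (1 / γ)) := by
  have hα := P.α_pos s
  have hQ : 0 ≤ Q := (abs_nonneg _).trans (hq a)
  have hL : 0 ≤ Real.log (1 / γ) := Real.log_nonneg (by rw [le_div_iff₀ hγ]; linarith)
  refine abs_sub_le_of_exchange (φ := Real.log) Real.strictMonoOn_log (P.pos_of_mem h.1)
    (P.pos_of_mem hy) (by positivity) (h.1.1.2.trans hy.1.2.symm) (fun a ha b => ?_) a
  have h1 := P.prox_exchange h hy ha b
  simp only [Params.gradPsi, hr] at h1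
  have hqa := (abs_le.1 (hq a)).2
  have hqb := (abs_le.1 (hq b)).1
  have hlb : Real.log (u b) ≤ 0 := Real.log_nonpos (P.pos_of_mem h.1 b).le
    (mem_Icc_of_mem_stdSimplex h.1.1 b).2
  have hla : -Real.log (1 / γ) ≤ Real.log (u a) := by
    rw [one_div, Real.log_inv, neg_neg]; exact Real.log_le_log hγ (hγu a)
  have h2 : P.α s / η * (Real.log (u a) - Real.log (y a) - (Real.log (u b) - Real.log (y b))) ≤
      2 * Q + c * P.α s * Real.log (1 / γ) := by
    have e : P.α s / η * (Real.log (u a) - Real.log (y a) - (Real.log (u b) - Real.log (y b))) =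
      1 / η * (P.α s * (Real.log (u a) + 1) - P.α s * (Real.log (y a) + 1)) -
      1 / η * (P.α s * (Real.log (u b) + 1) - P.α s * (Real.log (y b) + 1)) := by ring
    have h3 : c * P.α s * (Real.log (u b) - Real.log (u a)) ≤ c * P.α s * Real.log (1 / γ) :=
      mul_le_mul_of_nonneg_left (by linarith) (by positivity)
    rw [e]
    linarith
  have h4 := mul_le_mul_of_nonneg_left h2 (show 0 ≤ η / P.α s by positivity)
  have e1 : ∀ x, η / P.α s * (P.α s / η * x) = x := fun x => by field_simp
  have e2 : η / P.α s * (2 * Q + c * P.α s * Real.log (1 / γ)) =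
    η * (2 * Q / P.α s + c * Real.log (1 / γ)) := by field_simp
  rwa [e1, e2] at h4

theorem Params.prox_stable_euclidean (hr : P.reg = .euclidean)
    (h : IsArgmin (P.proxObjective s c η q y) (P.perturbedSimplex s) u)
    (hy : y ∈ P.perturbedSimplex s) {Q : ℝ} (hη : 0 < η) (hc : 0 ≤ c) (hq : ∀ a, |q a| ≤ Q)
    (a : A s) :
    |u a - y a| ≤
      η * (Fintype.card (A s) / P.α s * Q + c * √(Fintype.card (A s))) := by
  have hα := P.α_pos s
  have hQ : 0 ≤ Q := (abs_nonneg _).trans (hq a)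
  refine abs_sub_le_of_exchange (φ := id) (strictMono_id.strictMonoOn _) (P.pos_of_mem h.1)
    (P.pos_of_mem hy) (by positivity) (h.1.1.2.trans hy.1.2.symm) (fun a ha b => ?_) a
  simp only [id]
  rcases eq_or_ne a b with rfl | hab
  · rw [sub_self]; positivity
  have h1 := P.prox_exchange h hy ha b
  simp only [Params.gradPsi, hr] at h1
  have hqa := (abs_le.1 (hq a)).2
  have hqb := (abs_le.1 (hq b)).1
  have hub := (mem_Icc_of_mem_stdSimplex h.1.1 b).2
  have hua := P.pos_of_mem h.1 a
  have hcard : (2 : ℝ) ≤ Fintype.card (A s) := by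
    exact_mod_cast Fintype.one_lt_card_iff.2 ⟨a, b, hab⟩
  have hsq : 1 ≤ √(Fintype.card (A s) : ℝ) := Real.one_le_sqrt.2 (by linarith)
  have h2 : P.α s / η * (u a - y a - (u b - y b)) ≤ 2 * Q + c * P.α s := by
    have e : P.α s / η * (u a - y a - (u b - y b)) =
      1 / η * (P.α s * u a - P.α s * y a) - 1 / η * (P.α s * u b - P.α s * y b) := by ring
    have h3 : c * P.α s * (u b - u a) ≤ c * P.α s * 1 :=
      mul_le_mul_of_nonneg_left (by linarith) (by positivity)
    rw [e]
    linarith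
  have h4 := mul_le_mul_of_nonneg_left h2 (show 0 ≤ η / P.α s by positivity)
  have e1 : ∀ x, η / P.α s * (P.α s / η * x) = x := fun x => by field_simp
  have e2 : η / P.α s * (2 * Q + c * P.α s) = η * (2 / P.α s * Q + c * 1) := by field_simp
  rw [e1, e2] at h4
  refine h4.trans (mul_le_mul_of_nonneg_left (add_le_add ?_ ?_) hη.le)
  · gcongr
  · gcongr

end

/-! ### Histories and perfect recall -/

section
variable {S : Type*} {A : S → Type*} {C : Type*} [Fintype C] {G : Game S A C}
  {h h' : Hist S A C} {s : S} {i : Fin 2} {π π' : Profile S A}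

theorem Game.mem_infoNodes : h ∈ G.infoNodes s ↔ h ∈ G.nodes ∧ G.turn h = .infoset s := by
  simp [Game.infoNodes]

theorem Game.mem_infoNodes_of_act {a : A s} (hm : Move.act s a :: h ∈ G.nodes) :
    h ∈ G.infoNodes s := by
  have hh := G.parent_mem _ _ hm
  refine G.mem_infoNodes.2 ⟨hh, ?_⟩
  rcases ht : G.turn h with _ | _ | s'
  · exact absurd hm (G.terminal_children h hh ht _)
  · obtain ⟨c, hc, -⟩ := (G.chance_children h hh ht _).1 hm
    cases hc
  · obtain ⟨a', ha'⟩ := (G.infoset_children h hh s' ht _).1 hm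
    cases ha'
    rfl

theorem Game.turn_of_chance {c : C} (hm : Move.chance c :: h ∈ G.nodes) :
    G.turn h = .chance ∧ 0 < G.chanceProb h c := by
  have hh := G.parent_mem _ _ hm
  rcases ht : G.turn h with _ | _ | s'
  · exact absurd hm (G.terminal_children h hh ht _)
  · obtain ⟨c', hc, hp⟩ := (G.chance_children h hh ht _).1 hm
    cases hc
    exact ⟨rfl, hp⟩
  · obtain ⟨a', ha'⟩ := (G.infoset_children h hh s' ht _).1 hm
    cases ha'

theorem Game.mem_nodes_of_suffix (hs : h <:+ h') (hm : h' ∈ G.nodes) : h ∈ G.nodes := by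
  obtain ⟨l, rfl⟩ := hs
  induction l with
  | nil => simpa using hm
  | cons m l ih => exact ih (G.parent_mem _ _ hm)

theorem Game.infoNodes_nonempty (G : Game S A C) (s : S) : (G.infoNodes s).Nonempty := by
  obtain ⟨h, hh, ht⟩ := G.infoset_nonempty s
  exact ⟨h, G.mem_infoNodes.2 ⟨hh, ht⟩⟩

theorem personalMoves_append (player : S → Fin 2) (i : Fin 2) (l h : Hist S A C) :
    personalMoves player i (l ++ h) = personalMoves player i l ++ personalMoves player i h := by
  induction l with
  | nil => simp [personalMoves]
  | cons m l ih =>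
    cases m with
    | chance c => simpa [personalMoves] using ih
    | act s a =>
      by_cases hp : player s = i <;> simp [personalMoves, hp, ih]

/-- The most recent own move on the path to a node was made at a node of its infoset, and the
moves before it are the past of that infoset. -/
theorem Game.exists_of_personalMoves_cons {p : Σ s, A s} {l : List (Σ s, A s)}
    (hh : h ∈ G.nodes) (hl : personalMoves G.player i h = p :: l) :
    ∃ h₀ ∈ G.infoNodes p.1, Move.act p.1 p.2 :: h₀ <:+ h ∧ G.player p.1 = i ∧
      l = personalMoves G.player i h₀ := by
  induction h with
  | nil => simp [personalMoves] at hl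
  | cons m h ih =>
    have hh' := G.parent_mem _ _ hh
    cases m with
    | chance c =>
      obtain ⟨h₀, h1, h2, h3⟩ := ih hh' hl
      exact ⟨h₀, h1, h2.trans (List.suffix_cons _ _), h3⟩
    | act s a =>
      by_cases hp : G.player s = i
      · simp only [personalMoves, hp, if_true, List.cons.injEq] at hl
        obtain ⟨rfl, rfl⟩ := hl
        exact ⟨h, G.mem_infoNodes_of_act hh, List.suffix_rfl, hp, rfl⟩
      · simp only [personalMoves, hp, if_false] at hl
        obtain ⟨h₀, h1, h2, h3⟩ := ih hh' hl
        exact ⟨h₀, h1, h2.trans (List.suffix_cons _ _), h3⟩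

theorem Game.personalMoves_eq (hh : h ∈ G.infoNodes s) :
    personalMoves G.player (G.player s) h = G.personal s :=
  have := G.mem_infoNodes.1 hh
  G.perfect_recall h this.1 s this.2

theorem Game.of_personal_eq_cons {p : Σ s, A s} {l : List (Σ s, A s)}
    (hl : G.personal s = p :: l) : G.player p.1 = G.player s ∧ l = G.personal p.1 := by
  obtain ⟨h, hh⟩ := G.infoNodes_nonempty s
  obtain ⟨h₀, h1, -, h3, h4⟩ := G.exists_of_personalMoves_cons (G.mem_infoNodes.1 hh).1
    ((G.personalMoves_eq hh).trans hl)
  exact ⟨h3, by rw [h4, ← h3, G.personalMoves_eq h1]⟩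

theorem Game.personal_of_suffix {p : Σ s, A s} {l : List (Σ s, A s)}
    (hl : p :: l <:+ G.personal s) : G.player p.1 = G.player s ∧ l = G.personal p.1 := by
  obtain ⟨k, hk⟩ := hl
  induction k generalizing s with
  | nil => exact G.of_personal_eq_cons hk.symm
  | cons r k ih =>
    obtain ⟨h1, h2⟩ := G.of_personal_eq_cons hk.symm
    obtain ⟨h3, h4⟩ := ih h2
    exact ⟨h3.trans h1, h4⟩

/-- Perfect recall excludes that a player acts twice at one infoset on a path. -/
theorem Game.personal_action_unique {a a' : A s} {s₀ : S} (ha : ⟨s, a⟩ ∈ G.personal s₀)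
    (ha' : ⟨s, a'⟩ ∈ G.personal s₀) : a = a' := by
  obtain ⟨k, l, h1⟩ := List.append_of_mem ha
  obtain ⟨k', l', h1'⟩ := List.append_of_mem ha'
  have e := (G.personal_of_suffix (p := ⟨s, a⟩) ⟨k, h1.symm⟩).2
  have e' := (G.personal_of_suffix (p := ⟨s, a'⟩) ⟨k', h1'.symm⟩).2
  have h2 := h1.symm.trans h1'
  have := (List.append_inj' h2 (by simp [e, e'])).2
  simp only [List.cons.injEq, Sigma.mk.injEq, heq_eq_eq, true_and] at this
  exact this.1

/-- An infoset does not contain two nodes of which one precedes the other. -/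
theorem Game.not_act_suffix {a : A s} (hh : h ∈ G.infoNodes s) (hh' : h' ∈ G.infoNodes s) :
    ¬ Move.act s a :: h <:+ h' := by
  rintro ⟨l, rfl⟩
  have h1 := G.personalMoves_eq hh'
  have h2 := G.personalMoves_eq hh
  rw [personalMoves_append] at h1
  simp only [personalMoves, if_true, h2] at h1
  have := congrArg List.length h1
  simp at this
  omega

theorem Game.infoNodes_antichain (hh : h ∈ G.infoNodes s) (hh' : h' ∈ G.infoNodes s)
    (hs : h <:+ h') : h = h' := by
  obtain ⟨l, rfl⟩ := hs
  rcases l.eq_nil_or_concat with rfl | ⟨l, m, rfl⟩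
  · rfl
  · have hs : m :: h <:+ l.concat m ++ h := ⟨l, by simp⟩
    have hm := G.mem_nodes_of_suffix hs (G.mem_infoNodes.1 hh').1
    obtain ⟨h1, h2⟩ := G.mem_infoNodes.1 hh
    obtain ⟨a, rfl⟩ := (G.infoset_children h h1 s h2 m).1 hm
    exact absurd hs (G.not_act_suffix hh hh')

/-! ### Reach probabilities -/

theorem Game.chanceReach_pos (hh : h ∈ G.nodes) : 0 < G.chanceReach h := by
  induction h with
  | nil => simp [Game.chanceReach]
  | cons m h ih =>
    have := ih (G.parent_mem _ _ hh)
    cases m with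
    | chance c => exact mul_pos (G.turn_of_chance hh).2 this
    | act s a => exact this

theorem Game.chanceReach_le_one (hh : h ∈ G.nodes) : G.chanceReach h ≤ 1 := by
  induction h with
  | nil => simp [Game.chanceReach]
  | cons m h ih =>
    have hp := G.parent_mem _ _ hh
    have := ih hp
    cases m with
    | chance c =>
      have ht := (G.turn_of_chance hh).1
      refine mul_le_one₀ ?_ (G.chanceReach_pos hp).le this
      rw [← G.chance_sum h hp ht]
      exact Finset.single_le_sum (fun c _ => G.chance_nonneg h hp ht c) (Finset.mem_univ c)
    | act s a => exact this

theorem Game.chanceMass_pos (G : Game S A C) (s : S) : 0 < G.chanceMass s :=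
  Finset.sum_pos (fun _ hh => G.chanceReach_pos (G.mem_infoNodes.1 hh).1) (G.infoNodes_nonempty s)

@[simp] theorem Game.playerReach_chance (c : C) :
    G.playerReach π i (.chance c :: h) = G.playerReach π i h := rfl

theorem Game.playerReach_act (s : S) (a : A s) :
    G.playerReach π i (.act s a :: h) =
      if G.player s = i then π s a * G.playerReach π i h else G.playerReach π i h := by
  by_cases hp : G.player s = i <;> simp [Game.playerReach, personalMoves, hp]

theorem Game.playerReach_congr (hπ : ∀ s, G.player s = i → π s = π' s) :
    G.playerReach π i h = G.playerReach π' i h := by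
  induction h with
  | nil => rfl
  | cons m h ih =>
    cases m with
    | chance c => simpa using ih
    | act s a =>
      rw [G.playerReach_act, G.playerReach_act, ih]
      split_ifs with hp
      · rw [hπ s hp]
      · rfl

theorem Game.playerReach_eq_ownReach (hh : h ∈ G.infoNodes s) :
    G.playerReach π (G.player s) h = G.ownReach π s := by
  rw [Game.playerReach, G.personalMoves_eq hh]; rfl

theorem Game.reach_eq (i : Fin 2) : G.reach π h =
    G.chanceReach h * G.playerReach π i h * G.playerReach π (1 - i) h := by
  unfold Game.reach
  fin_cases i
  · rfl
  · exact mul_right_comm _ _ _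

theorem Game.playerReach_nonneg (hπ : ∀ s a, 0 ≤ π s a) : 0 ≤ G.playerReach π i h :=
  List.prod_nonneg (by simpa using fun s a _ => by rintro - rfl; exact hπ _ _)

theorem Game.reach_nonneg (hπ : ∀ s a, 0 ≤ π s a) (hh : h ∈ G.nodes) : 0 ≤ G.reach π h :=
  mul_nonneg (mul_nonneg (G.chanceReach_pos hh).le (G.playerReach_nonneg hπ))
    (G.playerReach_nonneg hπ)

theorem Game.reach_act (s : S) (a : A s) : G.reach π (.act s a :: h) = π s a * G.reach π h := by
  rw [G.reach_eq (G.player s), G.reach_eq (G.player s), G.playerReach_act, G.playerReach_act]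
  have : G.player s ≠ 1 - G.player s := by
    generalize G.player s = p; fin_cases p <;> decide
  simp only [if_true, if_neg this, Game.chanceReach]
  ring

theorem Game.reach_chance (c : C) :
    G.reach π (.chance c :: h) = G.chanceProb h c * G.reach π h := by
  simp only [Game.reach, Game.chanceReach, G.playerReach_chance]; ring

open Classical in
/-- Substochastic strategies reach an antichain below `h` at most as often as `h` itself. -/
theorem Game.sum_reach_le [∀ s, Fintype (A s)] (hπ : ∀ s a, 0 ≤ π s a) (hπ1 : ∀ s, ∑ a, π s a ≤ 1)
    (Z : Finset (Hist S A C)) (hZ : Z ⊆ G.nodes)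
    (hanti : ∀ z ∈ Z, ∀ z' ∈ Z, z <:+ z' → z = z') (hh : h ∈ G.nodes) :
    ∑ z ∈ Z with h <:+ z, G.reach π z ≤ G.reach π h := by
  have hlen : ∀ z ∈ G.nodes, z.length ≤ G.nodes.sup List.length := fun z hz =>
    Finset.le_sup (f := List.length) hz
  induction hn : G.nodes.sup List.length - h.length using Nat.strong_induction_on
    generalizing h with
  | _ n ih =>
    have hr := G.reach_nonneg hπ hh
    have hstep : ∀ m, ∑ z ∈ Z with m :: h <:+ z, G.reach π z ≤
        if m :: h ∈ G.nodes then G.reach π (m :: h) else 0 := by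
      intro m
      split_ifs with hm
      · have := hlen _ hm
        rw [List.length_cons] at this
        exact ih _ (by rw [← hn, List.length_cons]; omega) hm rfl
      · refine (Finset.sum_eq_zero fun z hz => ?_).le
        rw [Finset.mem_filter] at hz
        exact absurd (G.mem_nodes_of_suffix hz.2 (hZ hz.1)) hm
    by_cases hhZ : h ∈ Z
    · have : Z.filter (fun z => h <:+ z) = {h} := by
        ext z
        simp only [Finset.mem_filter, Finset.mem_singleton]
        exact ⟨fun hz => (hanti h hhZ z hz.1 hz.2).symm, by rintro rfl; exact ⟨hhZ, List.suffix_rfl⟩⟩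
      rw [this, Finset.sum_singleton]
    have hchild : ∀ z ∈ Z, h <:+ z → ∃ m, m :: h <:+ z ∧ m :: h ∈ G.nodes := by
      rintro z hz ⟨l, rfl⟩
      rcases l.eq_nil_or_concat with rfl | ⟨l, m, rfl⟩
      · exact absurd hz hhZ
      · have hs : m :: h <:+ l.concat m ++ h := ⟨l, by simp⟩
        exact ⟨m, hs, G.mem_nodes_of_suffix hs (hZ hz)⟩
    have hsplit : ∀ M : Finset (Move S A C), (∀ m, m :: h ∈ G.nodes → m ∈ M) →
        ∑ z ∈ Z with h <:+ z, G.reach π z ≤ ∑ m ∈ M, ∑ z ∈ Z with m :: h <:+ z, G.reach π z := by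
      intro M hM
      simp only [Finset.sum_filter]
      rw [Finset.sum_comm]
      refine Finset.sum_le_sum fun z hz => ?_
      have hz0 := G.reach_nonneg hπ (hZ hz)
      split_ifs with hs
      · obtain ⟨m, hm, hmn⟩ := hchild z hz hs
        refine le_trans (by rw [if_pos hm]) (Finset.single_le_sum (f := fun m =>
          if m :: h <:+ z then G.reach π z else 0) (fun y _ => ?_) (hM m hmn))
        split_ifs <;> simp [hz0]
      · exact Finset.sum_nonneg fun y _ => by split_ifs <;> simp [hz0]
    rcases ht : G.turn h with _ | _ | s
    · refine (Finset.sum_eq_zero fun z hz => ?_).le.trans hr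
      rw [Finset.mem_filter] at hz
      obtain ⟨m, -, hm⟩ := hchild z hz.1 hz.2
      exact absurd hm (G.terminal_children h hh ht m)
    · calc _ ≤ ∑ c, ∑ z ∈ Z with Move.chance c :: h <:+ z, G.reach π z := by
            rw [← Finset.sum_image (g := fun c => Move.chance c)
              (f := fun m => ∑ z ∈ Z with m :: h <:+ z, G.reach π z)
              (fun _ _ _ _ e => Move.chance.inj e)]
            refine hsplit _ fun m hm => ?_
            obtain ⟨c, rfl, -⟩ := (G.chance_children h hh ht m).1 hm
            exact Finset.mem_image_of_mem _ (Finset.mem_univ c)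
        _ ≤ ∑ c, G.chanceProb h c * G.reach π h := by
            refine Finset.sum_le_sum fun c _ => (hstep _).trans ?_
            split_ifs
            · rw [G.reach_chance]
            · exact mul_nonneg (G.chance_nonneg h hh ht c) hr
        _ = _ := by rw [← Finset.sum_mul, G.chance_sum h hh ht, one_mul]
    · calc _ ≤ ∑ a, ∑ z ∈ Z with Move.act s a :: h <:+ z, G.reach π z := by
            rw [← Finset.sum_image (g := fun a => Move.act s a)
              (f := fun m => ∑ z ∈ Z with m :: h <:+ z, G.reach π z)
              (fun _ _ _ _ e => by simpa using e)]
            refine hsplit _ fun m hm => ?_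
            obtain ⟨a, rfl⟩ := (G.infoset_children h hh s ht m).1 hm
            exact Finset.mem_image_of_mem _ (Finset.mem_univ a)
        _ ≤ ∑ a, π s a * G.reach π h := by
            refine Finset.sum_le_sum fun a _ => (hstep _).trans ?_
            split_ifs
            · rw [G.reach_act]
            · exact mul_nonneg (hπ s a) hr
        _ ≤ _ := by
            rw [← Finset.sum_mul]
            exact mul_le_of_le_one_left hr (hπ1 s)

open Classical in
/-- The opponent and chance reach an infoset with total weight at most one: this is the probability
of reaching it when the acting player plays towards it. -/
theorem Game.oppReach_le_one [∀ s, Fintype (A s)] (hπ : ∀ s, π s ∈ stdSimplex ℝ (A s)) (s : S) :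
    G.oppReach π s ≤ 1 := by
  set ρ : Profile S A := fun s' a =>
    if G.player s' = G.player s then (if ⟨s', a⟩ ∈ G.personal s then 1 else 0) else π s' a with hρ
  have h0 : ∀ s' a, 0 ≤ ρ s' a := by
    intro s' a
    simp only [hρ]
    split_ifs
    exacts [zero_le_one, le_rfl, (hπ s').1 a]
  have h1 : ∀ s', ∑ a, ρ s' a ≤ 1 := by
    intro s'
    by_cases hp : G.player s' = G.player s
    · simp only [hρ, if_pos hp]
      by_cases hex : ∃ a, ⟨s', a⟩ ∈ G.personal s
      · obtain ⟨a, ha⟩ := hex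
        have : ∀ b, (if ⟨s', b⟩ ∈ G.personal s then (1 : ℝ) else 0) = if b = a then 1 else 0 :=
          fun b => if_congr ⟨fun hb => G.personal_action_unique hb ha, by rintro rfl; exact ha⟩
            rfl rfl
        simp [this]
      · push Not at hex
        simp [hex]
    · simp only [hρ, if_neg hp]
      exact (hπ s').2.le
  have h2 := G.sum_reach_le h0 h1 (G.infoNodes s) (Finset.filter_subset _ _)
    (fun z hz z' hz' => G.infoNodes_antichain hz hz') G.root_mem
  have h3 : G.reach ρ [] = 1 := by
    simp [Game.reach, Game.chanceReach, Game.playerReach, personalMoves]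
  rw [h3, Finset.filter_true_of_mem (fun z _ => List.nil_suffix)] at h2
  refine le_trans (le_of_eq ?_) h2
  refine Finset.sum_congr rfl fun h hh => ?_
  rw [G.reach_eq (G.player s)]
  have e1 : G.playerReach ρ (G.player s) h = 1 := by
    rw [Game.playerReach, G.personalMoves_eq hh]
    refine List.prod_eq_one fun x hx => ?_
    obtain ⟨p, hp, rfl⟩ := List.mem_map.1 hx
    obtain ⟨k, l, hk⟩ := List.append_of_mem hp
    have := (G.personal_of_suffix (p := p) ⟨k, hk.symm⟩).1
    simp [hρ, this, hp]
  have e2 : G.playerReach ρ (1 - G.player s) h = G.playerReach π (1 - G.player s) h := by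
    refine G.playerReach_congr fun s' hs' => ?_
    have : G.player s' ≠ G.player s := by
      rw [hs']
      generalize G.player s = p; fin_cases p <;> decide
    funext a
    simp [hρ, this]
  rw [e1, e2, mul_one]

theorem Game.ownReach_cons {p : Σ s, A s} {l : List (Σ s, A s)} (hl : G.personal s = p :: l) :
    G.ownReach π s = G.seqForm π p := by
  rw [Game.ownReach, hl, (G.of_personal_eq_cons hl).2, List.map_cons, List.prod_cons, mul_comm]
  rfl

theorem Game.playerReach_cons {p : Σ s, A s} {l : List (Σ s, A s)} (hh : h ∈ G.nodes)
    (hl : personalMoves G.player i h = p :: l) : G.playerReach π i h = G.seqForm π p := by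
  obtain ⟨h₀, h1, -, h3, h4⟩ := G.exists_of_personalMoves_cons hh hl
  rw [Game.playerReach, hl, List.map_cons, List.prod_cons, h4, ← h3, G.personalMoves_eq h1,
    mul_comm]
  rfl

theorem Game.atParent_seqForm : G.atParent (G.seqForm π) s = G.ownReach π s := by
  unfold Game.atParent Game.parentSeq
  rcases hl : G.personal s with _ | ⟨p, l⟩
  · simp [Game.ownReach, hl]
  · simpa using (G.ownReach_cons hl).symm

section Feasible
variable [∀ s, Fintype (A s)] {P : Params S A} {γ : ℝ}

theorem Params.Feasible.pos (hπ : P.Feasible π) (s : S) (a : A s) : 0 < π s a :=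
  P.pos_of_mem (hπ s) a

theorem Params.Feasible.le_one (hπ : P.Feasible π) (s : S) (a : A s) : π s a ≤ 1 :=
  (mem_Icc_of_mem_stdSimplex (hπ s).1 a).2

theorem Params.Feasible.prod_mem (hπ : P.Feasible π) (l : List (Σ s, A s)) :
    (l.map fun p => π p.1 p.2).prod ∈ Set.Ioc (0 : ℝ) 1 := by
  induction l with
  | nil => simp
  | cons p l ih =>
    rw [List.map_cons, List.prod_cons]
    exact ⟨mul_pos (hπ.pos _ _) ih.1, mul_le_one₀ (hπ.le_one _ _) ih.1.le ih.2⟩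

theorem Params.Feasible.playerReach_mem (hπ : P.Feasible π) :
    G.playerReach π i h ∈ Set.Ioc (0 : ℝ) 1 := hπ.prod_mem _

theorem Params.Feasible.ownReach_mem (hπ : P.Feasible π) (s : S) :
    G.ownReach π s ∈ Set.Ioc (0 : ℝ) 1 := hπ.prod_mem _

theorem Params.Feasible.seqForm_pos (hπ : P.Feasible π) (p : Σ s, A s) : 0 < G.seqForm π p :=
  mul_pos (hπ.ownReach_mem _).1 (hπ.pos _ _)

theorem Params.Feasible.seqForm_le (hπ : P.Feasible π) (p : Σ s, A s) :
    G.seqForm π p ≤ π p.1 p.2 :=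
  mul_le_of_le_one_left (hπ.pos _ _).le (hπ.ownReach_mem _).2

theorem Game.IsReachBound.le (hγ : G.IsReachBound P γ) (hπ : P.Feasible π) (s : S) (a : A s) :
    γ ≤ π s a := (hγ.2 π hπ ⟨s, a⟩).trans (hπ.seqForm_le _)

theorem Game.IsReachBound.le_one [Nonempty S] [∀ s, Nonempty (A s)] (hγ : G.IsReachBound P γ)
    (hπ : P.Feasible π) : γ ≤ 1 := by
  obtain ⟨s⟩ := ‹Nonempty S›
  obtain ⟨a⟩ := ‹∀ s, Nonempty (A s)› s
  exact (hγ.le hπ s a).trans (hπ.le_one s a)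

theorem Game.IsReachBound.le_playerReach [Nonempty S] [∀ s, Nonempty (A s)]
    (hγ : G.IsReachBound P γ) (hπ : P.Feasible π) (hh : h ∈ G.nodes) :
    γ ≤ G.playerReach π i h := by
  rcases hl : personalMoves G.player i h with _ | ⟨p, l⟩
  · simpa [Game.playerReach, hl] using hγ.le_one hπ
  · rw [G.playerReach_cons hh hl]
    exact hγ.2 π hπ p

theorem Game.IsReachBound.le_ownReach [Nonempty S] [∀ s, Nonempty (A s)]
    (hγ : G.IsReachBound P γ) (hπ : P.Feasible π) (s : S) : γ ≤ G.ownReach π s := by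
  obtain ⟨h, hh⟩ := G.infoNodes_nonempty s
  rw [← G.playerReach_eq_ownReach hh]
  exact hγ.le_playerReach hπ (G.mem_infoNodes.1 hh).1

theorem Game.IsReachBound.le_oppReach [Nonempty S] [∀ s, Nonempty (A s)]
    (hγ : G.IsReachBound P γ) (hπ : P.Feasible π) (s : S) :
    γ * G.chanceMass s ≤ G.oppReach π s := by
  rw [Game.chanceMass, Finset.mul_sum]
  refine Finset.sum_le_sum fun h hh => ?_
  have hn := (G.mem_infoNodes.1 hh).1
  rw [mul_comm]
  exact mul_le_mul_of_nonneg_left (hγ.le_playerReach hπ hn) (G.chanceReach_pos hn).le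

theorem Params.Feasible.oppReach_pos (hπ : P.Feasible π) (s : S) : 0 < G.oppReach π s :=
  Finset.sum_pos (fun _ hh => mul_pos (G.chanceReach_pos (G.mem_infoNodes.1 hh).1)
    hπ.playerReach_mem.1) (G.infoNodes_nonempty s)

theorem Params.Feasible.oppReach_le_one (hπ : P.Feasible π) (s : S) : G.oppReach π s ≤ 1 :=
  G.oppReach_le_one (fun s => (hπ s).1) s

/-! ### The factors that turn feedback into counterfactual values -/

theorem Params.Feasible.weight_pos (hπ : P.Feasible π) (f : Feedback) (s : S) :
    0 < G.weight f π s := by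
  cases f
  · exact one_pos
  · exact one_div_pos.2 (hπ.ownReach_mem s).1
  · exact hπ.oppReach_pos s

theorem Game.sum_reach_infoNodes :
    ∑ h ∈ G.infoNodes s, G.reach π h = G.ownReach π s * G.oppReach π s := by
  rw [Game.oppReach, Finset.mul_sum]
  refine Finset.sum_congr rfl fun h hh => ?_
  rw [G.reach_eq (G.player s), G.playerReach_eq_ownReach hh]
  ring

theorem Game.cfValue_eq_trajQ (s : S) (a : A s) :
    G.cfValue P π s a = 1 / G.ownReach π s * G.trajQ P π s a := by
  rw [Game.cfValue, Game.trajQ, ← mul_assoc, Finset.mul_sum]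
  refine Finset.sum_congr rfl fun h hh => ?_
  rw [G.reach_eq (G.player s), Game.seqForm]
  simp only [div_eq_mul_inv, mul_inv]
  ring

theorem Params.Feasible.weight_mul_feedback (hπ : P.Feasible π) (f : Feedback) (s : S) (a : A s) :
    G.weight f π s * G.feedback P f π s a = G.cfValue P π s a := by
  cases f
  · simp [Game.weight, Game.feedback]
  · simp only [Game.weight, Game.feedback]
    rw [Game.cfValue_eq_trajQ]
  · simp only [Game.weight, Game.feedback, Game.condQ]
    rw [Game.cfValue_eq_trajQ, Game.sum_reach_infoNodes]
    have h1 := (hπ.ownReach_mem (G := G) s).1.ne'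
    have h2 := (hπ.oppReach_pos (G := G) s).ne'
    field_simp

variable [Nonempty S] [∀ s, Nonempty (A s)]

theorem Game.IsReachBound.weight_le (hγ : G.IsReachBound P γ) (hπ : P.Feasible π) (f : Feedback)
    (s : S) : G.weight f π s ≤ M2 f γ := by
  cases f
  · exact le_rfl
  · exact one_div_le_one_div_of_le hγ.1 (hγ.le_ownReach hπ s)
  · exact hπ.oppReach_le_one s

variable [Finite S]

theorem Game.iInf_chanceMass_le (G : Game S A C) (s : S) : ⨅ s, G.chanceMass s ≤ G.chanceMass s :=
  ciInf_le (Set.finite_range _).bddBelow s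

theorem Game.iInf_chanceMass_pos (G : Game S A C) : 0 < ⨅ s, G.chanceMass s := by
  obtain ⟨s, hs⟩ := exists_eq_ciInf_of_finite (f := G.chanceMass)
  rw [← hs]
  exact G.chanceMass_pos s

theorem Game.IsReachBound.M1_pos (hγ : G.IsReachBound P γ) (f : Feedback) : 0 < G.M1 f γ := by
  cases f
  · exact one_pos
  · exact one_pos
  · exact mul_pos hγ.1 G.iInf_chanceMass_pos

theorem Game.IsReachBound.M1_le_weight (hγ : G.IsReachBound P γ) (hπ : P.Feasible π) (f : Feedback)
    (s : S) : G.M1 f γ ≤ G.weight f π s := by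
  cases f
  · exact le_rfl
  · exact (one_le_div (hπ.ownReach_mem s).1).2 (hπ.ownReach_mem s).2
  · exact (mul_le_mul_of_nonneg_left (G.iInf_chanceMass_le s) hγ.1.le).trans (hγ.le_oppReach hπ s)

/-- The effective weight of the regularizer is at most `τ / M₁`. -/
theorem Game.IsReachBound.coeff_le (hγ : G.IsReachBound P γ) (hπ : P.Feasible π) (f : Feedback)
    (s : S) : P.τ * G.oppReach π s / G.weight f π s ≤ P.τ / G.M1 f γ := by
  have h1 := hπ.oppReach_le_one (G := G) s
  have h2 := P.τ_pos
  refine div_le_div₀ h2.le ?_ (hγ.M1_pos f) (hγ.M1_le_weight hπ f s)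
  exact mul_le_of_le_one_right h2.le h1

end Feasible

end

/-! ### Decomposition of the regret into counterfactual regrets -/

section
variable {S : Type*} {A : S → Type*} {C : Type*} [Fintype C] [∀ s, Fintype (A s)]
  {G : Game S A C} {P : Params S A}
  {h h' : Hist S A C} {s : S} {i : Fin 2} {π x y : Profile S A}

theorem Game.mem_below {a : A s} :
    h ∈ G.below s a ↔ h ∈ G.nodes ∧ ∃ h₀ ∈ G.infoNodes s, Move.act s a :: h₀ <:+ h := by
  simp [Game.below]

theorem Game.cons_mem_below {m : Move S A C} {a : A s} (hm : m :: h ∈ G.nodes) :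
    m :: h ∈ G.below s a ↔ m = Move.act s a ∨ h ∈ G.below s a := by
  rw [G.mem_below, G.mem_below]
  constructor
  · rintro ⟨-, h₀, h1, h2⟩
    rcases List.suffix_cons_iff.1 h2 with h3 | h3
    · exact Or.inl (List.cons.inj h3).1.symm
    · exact Or.inr ⟨G.parent_mem _ _ hm, h₀, h1, h3⟩
  · rintro (rfl | ⟨-, h₀, h1, h2⟩)
    · exact ⟨hm, h, G.mem_infoNodes_of_act hm, List.suffix_rfl⟩
    · exact ⟨hm, h₀, h1, h2.trans (List.suffix_cons _ _)⟩

variable [Fintype S]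

open Classical in
/-- Telescoping of the difference of two products along the path to a node: each summand replaces
one factor `π s a` by `x s a`, with `x` before and `π` after it. -/
theorem Game.playerReach_sub (hπ : P.Feasible π) (hh : h ∈ G.nodes) :
    G.playerReach x i h - G.playerReach π i h =
      ∑ p : Σ s, A s with G.player p.1 = i, if h ∈ G.below p.1 p.2 then
        G.ownReach x p.1 * (x p.1 p.2 - π p.1 p.2) * (G.playerReach π i h / G.seqForm π p)
      else 0 := by
  induction h with
  | nil =>
    have : ∀ p : Σ s, A s, ([] : Hist S A C) ∉ G.below p.1 p.2 := by
      intro p hp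
      obtain ⟨-, h₀, -, h2⟩ := G.mem_below.1 hp
      simp at h2
    simp [this, Game.playerReach, personalMoves]
  | cons m h ih =>
    have hn := G.parent_mem _ _ hh
    specialize ih hn
    cases m with
    | chance c =>
      simp only [G.playerReach_chance, ih, G.cons_mem_below hh, reduceCtorEq, false_or]
    | act s₀ a₀ =>
      by_cases hp : G.player s₀ = i
      · have hs₀ := G.mem_infoNodes_of_act hh
        have hX : ∀ ρ : Profile S A, G.playerReach ρ i h = G.ownReach ρ s₀ := fun ρ => by
          rw [← hp, G.playerReach_eq_ownReach hs₀]
        have hnot : h ∉ G.below s₀ a₀ := by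
          intro hb
          obtain ⟨-, h₀, h1, h2⟩ := G.mem_below.1 hb
          exact G.not_act_suffix h1 hs₀ h2
        have key : ∀ p : Σ s, A s, (if Move.act s₀ a₀ :: h ∈ G.below p.1 p.2 then
            G.ownReach x p.1 * (x p.1 p.2 - π p.1 p.2) *
              (π s₀ a₀ * G.playerReach π i h / G.seqForm π p) else 0) =
            π s₀ a₀ * (if h ∈ G.below p.1 p.2 then G.ownReach x p.1 * (x p.1 p.2 - π p.1 p.2) *
              (G.playerReach π i h / G.seqForm π p) else 0) +
            if p = ⟨s₀, a₀⟩ then G.ownReach x s₀ * (x s₀ a₀ - π s₀ a₀) else 0 := by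
          rintro ⟨s, a⟩
          by_cases he : (⟨s, a⟩ : Σ s, A s) = ⟨s₀, a₀⟩
          · cases he
            have h0 := (hπ.seqForm_pos (G := G) ⟨s₀, a₀⟩).ne'
            have h1 : π s₀ a₀ * G.playerReach π i h = G.seqForm π ⟨s₀, a₀⟩ := by
              rw [hX, mul_comm]; rfl
            simp [G.cons_mem_below hh, hnot, h1, div_self h0]
          · have h1 : Move.act s₀ a₀ :: h ∈ G.below s a ↔ h ∈ G.below s a := by
              rw [G.cons_mem_below hh]
              refine or_iff_right fun e => he ?_
              cases e; rfl
            simp only [h1, he, if_false, add_zero, mul_ite, mul_zero]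
            split_ifs
            · ring
            · rfl
        have hsum : ∑ p : Σ s, A s with G.player p.1 = i,
            (if p = ⟨s₀, a₀⟩ then G.ownReach x s₀ * (x s₀ a₀ - π s₀ a₀) else 0) =
            G.ownReach x s₀ * (x s₀ a₀ - π s₀ a₀) := by
          rw [Finset.sum_ite_eq', if_pos (by simpa using hp)]
        simp only [G.playerReach_act, hp, if_true, key]
        rw [Finset.sum_add_distrib, ← Finset.mul_sum, ← ih, hsum, ← hX x]
        ring
      · simp only [G.playerReach_act, hp, if_false]
        rw [ih]
        refine Finset.sum_congr rfl fun p hp' => ?_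
        have : Move.act s₀ a₀ :: h ∈ G.below p.1 p.2 ↔ h ∈ G.below p.1 p.2 := by
          rw [G.cons_mem_below hh]
          refine or_iff_right fun e => hp ?_
          cases e
          exact (Finset.mem_filter.1 hp').2
        simp only [this]

open Classical in
theorem Game.sum_nodes_infoset (F : Hist S A C → ℝ) (g : S → ℝ) :
    ∑ h ∈ G.nodes, F h * (∑ s, if G.turn h = .infoset s then g s else 0) =
      ∑ s, (∑ h ∈ G.infoNodes s, F h) * g s := by
  simp only [Finset.mul_sum]
  rw [Finset.sum_comm]
  refine Finset.sum_congr rfl fun s _ => ?_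
  rw [Game.infoNodes, Finset.sum_filter, Finset.sum_mul]
  refine Finset.sum_congr rfl fun h _ => ?_
  split_ifs <;> simp

open Classical in
theorem Game.nodeReward_eq : G.nodeReward P π i h =
    (if G.turn h = .terminal then (if i = 0 then G.payoff h else -G.payoff h) else 0) +
    ∑ s, if G.turn h = .infoset s then
      (if G.player s = i then -(P.τ * P.psi s (π s)) else P.τ * P.psi s (π s)) else 0 := by
  unfold Game.nodeReward
  rcases G.turn h with _ | _ | s <;> simp

/-- The expected reward of player `i` in the regularized game. -/
noncomputable def Game.value (G : Game S A C) (P : Params S A) (i : Fin 2) (π : Profile S A) : ℝ :=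
  ∑ h ∈ G.nodes, G.reach π h * G.nodeReward P π i h

theorem Game.value_zero : G.value P 0 π = G.objective P π := by
  classical
  have e : ∀ s, (∑ h ∈ G.infoNodes s, G.reach π h) *
      (if G.player s = 0 then -(P.τ * P.psi s (π s)) else P.τ * P.psi s (π s)) =
      -(P.τ * if G.player s = 0 then G.ownReach π s * G.oppReach π s * P.psi s (π s) else 0) +
      P.τ * (if G.player s = 1 then G.ownReach π s * G.oppReach π s * P.psi s (π s) else 0) := by
    intro s
    rw [G.sum_reach_infoNodes]
    have : G.player s = 0 ∨ G.player s = 1 := by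
      generalize G.player s = p; fin_cases p <;> simp
    rcases this with hp | hp <;> simp [hp] <;> ring
  simp only [Game.value, G.nodeReward_eq, mul_add, Finset.sum_add_distrib]
  rw [G.sum_nodes_infoset]
  simp only [e, Finset.sum_add_distrib, Finset.sum_neg_distrib, ← Finset.mul_sum, if_true,
    mul_ite, mul_zero, ← Finset.sum_filter]
  simp only [Game.objective, Game.utility, Game.bidilated, Finset.sum_filter]
  ring

theorem Game.value_one : G.value P 1 π = -G.objective P π := by
  rw [← G.value_zero, Game.value, Game.value, ← Finset.sum_neg_distrib]
  refine Finset.sum_congr rfl fun h _ => ?_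
  rw [← mul_neg]
  congr 1
  unfold Game.nodeReward
  rcases G.turn h with _ | _ | s
  · simp
  · simp
  · have : G.player s = 0 ∨ G.player s = 1 := by
      generalize G.player s = p; fin_cases p <;> simp
    rcases this with hp | hp <;> simp [hp]

/-- The regularized counterfactual regret of `π` against `u` at the infoset `s`. -/
noncomputable def Game.localRegret (G : Game S A C) (P : Params S A) (π : Profile S A) (s : S)
    (u : A s → ℝ) : ℝ :=
  ∑ a, (u a - π s a) * G.cfValue P π s a + P.τ * G.oppReach π s * (P.psi s (π s) - P.psi s u)

/-- The gain of player `i` from a deviation to `x` is the sum of the local regrets, weighted with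
the reach probabilities of `x`. -/
theorem Game.value_sub (hπ : P.Feasible π) (hyx : ∀ s, G.player s = i → y s = x s)
    (hyπ : ∀ s, G.player s ≠ i → y s = π s) :
    G.value P i y - G.value P i π =
      ∑ s with G.player s = i, G.ownReach x s * G.localRegret P π s (x s) := by
  classical
  have hi : i ≠ 1 - i := by fin_cases i <;> decide
  have e1 : ∀ h, G.playerReach y i h = G.playerReach x i h := fun h => G.playerReach_congr hyx
  have e2 : ∀ h, G.playerReach y (1 - i) h = G.playerReach π (1 - i) h := fun h =>
    G.playerReach_congr fun s hs => hyπ s fun h' => hi (h'.symm.trans hs)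
  have e3 : ∀ h, G.nodeReward P y i h = G.nodeReward P π i h +
      ∑ s, if G.turn h = .infoset s then
        (if G.player s = i then P.τ * (P.psi s (π s) - P.psi s (x s)) else 0) else 0 := by
    intro h
    rw [G.nodeReward_eq, G.nodeReward_eq, add_assoc, ← Finset.sum_add_distrib]
    congr 1
    refine Finset.sum_congr rfl fun s _ => ?_
    by_cases h1 : G.turn h = .infoset s
    · by_cases h2 : G.player s = i
      · simp only [h1, h2, if_true, hyx s h2]; ring
      · simp [h1, h2, hyπ s h2]
    · simp [h1]
  have e4 : G.value P i y - G.value P i π =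
      ∑ h ∈ G.nodes, G.chanceReach h * (G.playerReach x i h - G.playerReach π i h) *
        G.playerReach π (1 - i) h * G.nodeReward P π i h +
      ∑ h ∈ G.nodes, G.chanceReach h * G.playerReach x i h * G.playerReach π (1 - i) h *
        ∑ s, (if G.turn h = .infoset s then
        (if G.player s = i then P.τ * (P.psi s (π s) - P.psi s (x s)) else 0) else 0) := by
    rw [Game.value, Game.value, ← Finset.sum_sub_distrib, ← Finset.sum_add_distrib]
    refine Finset.sum_congr rfl fun h _ => ?_
    rw [G.reach_eq i, G.reach_eq i, e1, e2, e3]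
    ring
  rw [e4, G.sum_nodes_infoset]
  have e5 : ∑ h ∈ G.nodes, G.chanceReach h * (G.playerReach x i h - G.playerReach π i h) *
        G.playerReach π (1 - i) h * G.nodeReward P π i h =
      ∑ p : Σ s, A s with G.player p.1 = i,
        G.ownReach x p.1 * ((x p.1 p.2 - π p.1 p.2) * G.cfValue P π p.1 p.2) := by
    have : ∀ h ∈ G.nodes, G.chanceReach h * (G.playerReach x i h - G.playerReach π i h) *
        G.playerReach π (1 - i) h * G.nodeReward P π i h =
        ∑ p : Σ s, A s with G.player p.1 = i, if h ∈ G.below p.1 p.2 then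
          G.ownReach x p.1 * (x p.1 p.2 - π p.1 p.2) *
          (G.chanceReach h * (G.playerReach π i h / G.seqForm π p) *
            G.playerReach π (1 - i) h * G.nodeReward P π i h) else 0 := by
      intro h hh
      rw [G.playerReach_sub hπ hh, Finset.mul_sum, Finset.sum_mul, Finset.sum_mul]
      refine Finset.sum_congr rfl fun p _ => ?_
      split_ifs
      · ring
      · simp
    rw [Finset.sum_congr rfl this, Finset.sum_comm]
    refine Finset.sum_congr rfl fun p hp => ?_
    have hp' := (Finset.mem_filter.1 hp).2
    have hb : G.below p.1 p.2 ⊆ G.nodes := Finset.filter_subset _ _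
    rw [← Finset.sum_filter, Finset.filter_mem_eq_inter, Finset.inter_eq_right.2 hb,
      ← Finset.mul_sum, ← mul_assoc, Game.cfValue, hp']
  have e6 : ∀ s, (∑ h ∈ G.infoNodes s, G.chanceReach h * G.playerReach x i h *
      G.playerReach π (1 - i) h) *
      (if G.player s = i then P.τ * (P.psi s (π s) - P.psi s (x s)) else 0) =
      if G.player s = i then
        G.ownReach x s * (P.τ * G.oppReach π s * (P.psi s (π s) - P.psi s (x s))) else 0 := by
    intro s
    split_ifs with hs
    · subst hs
      have : ∑ h ∈ G.infoNodes s, G.chanceReach h * G.playerReach x (G.player s) h *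
          G.playerReach π (1 - G.player s) h = G.ownReach x s * G.oppReach π s := by
        rw [Game.oppReach, Finset.mul_sum]
        refine Finset.sum_congr rfl fun h hh => ?_
        rw [G.playerReach_eq_ownReach hh]
        ring
      rw [this]; ring
    · simp
  rw [e5, Finset.sum_congr rfl fun s _ => e6 s, ← Finset.sum_filter, Finset.sum_filter,
    Fintype.sum_sigma, Finset.sum_filter, Finset.sum_filter, ← Finset.sum_add_distrib]
  refine Finset.sum_congr rfl fun s _ => ?_
  split_ifs
  · rw [Game.localRegret, mul_add, Finset.mul_sum]
  · simp

/-- At a saddle point `x`, the weighted local regrets of any feasible profile against `x` have a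
non-negative sum. -/
theorem Game.IsRegularizedNash.sum_localRegret_nonneg (hx : G.IsRegularizedNash P x)
    (hπ : P.Feasible π) : 0 ≤ ∑ s, G.ownReach x s * G.localRegret P π s (x s) := by
  have h0 := G.value_sub (P := P) (i := 0) (y := G.combine x π) (x := x) hπ
    (fun s hs => by simp [Game.combine, hs]) (fun s hs => by simp [Game.combine, hs])
  have h1 := G.value_sub (P := P) (i := 1) (y := G.combine π x) (x := x) hπ
    (fun s hs => by simp [Game.combine, hs]) (fun s hs => by
      have : G.player s = 0 := by
        revert hs; generalize G.player s = p; fin_cases p <;> simp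
      simp [Game.combine, this])
  rw [G.value_zero, G.value_zero] at h0
  rw [G.value_one, G.value_one] at h1
  have h2 := hx.2.1 π hπ
  have h3 := hx.2.2 π hπ
  have h4 : ∑ s, G.ownReach x s * G.localRegret P π s (x s) =
      ∑ s with G.player s = 0, G.ownReach x s * G.localRegret P π s (x s) +
      ∑ s with G.player s = 1, G.ownReach x s * G.localRegret P π s (x s) := by
    rw [← Finset.sum_filter_add_sum_filter_not Finset.univ fun s => G.player s = 0]
    congr 1
    refine Finset.sum_congr (Finset.filter_congr fun s _ => ?_) fun _ _ => rfl
    generalize G.player s = p; fin_cases p <;> simp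
  rw [h4, ← h0, ← h1]
  linarith

/-! ### The divergence of the dilated regularizer -/

/-- The divergence of the dilated regularizer is the sum of the local divergences, weighted with
the reach probabilities of the first argument. -/
theorem Game.divergence_eq (hx : P.Feasible x) (hy : P.Feasible y) :
    G.divergence P x y = ∑ s, G.ownReach x s * bregman (P.psi s) (x s) (y s) := by
  set X := G.seqForm x with hX
  set Y := G.seqForm y with hY
  -- the part of a functional on sequences that reads the entry at `σ(s)`
  let par : S → (((Σ s, A s) → ℝ) →L[ℝ] ℝ) := fun s =>
    match G.parentSeq s with
    | none => 0
    | some p => ContinuousLinearMap.proj (R := ℝ) (φ := fun _ : (Σ s, A s) => ℝ) p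
  have hpar : ∀ s z, HasFDerivAt (fun z => G.atParent z s) (par s) z := by
    intro s z
    simp only [Game.atParent, par]
    cases G.parentSeq s with
    | none => exact hasFDerivAt_const _ _
    | some p => exact hasFDerivAt_apply p z
  have hparsub : ∀ s, par s (X - Y) = G.ownReach x s - G.ownReach y s := by
    intro s
    rw [← G.atParent_seqForm (π := x), ← G.atParent_seqForm (π := y)]
    simp only [Game.atParent, par]
    cases G.parentSeq s with
    | none => simp
    | some p => simp [hX, hY]
  have hatX : ∀ s, G.atParent X s = G.ownReach x s := fun s => G.atParent_seqForm
  have hatY : ∀ s, G.atParent Y s = G.ownReach y s := fun s => G.atParent_seqForm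
  have hquot : ∀ {z : Profile S A} (_ : P.Feasible z) s,
      (fun a => G.seqForm z ⟨s, a⟩ / G.ownReach z s) = z s := by
    intro z hz s
    funext a
    exact mul_div_cancel_left₀ _ (hz.ownReach_mem s).1.ne'
  have hderiv : ∀ s, ∃ L : ((Σ s, A s) → ℝ) →L[ℝ] ℝ,
      HasFDerivAt (fun z => G.atParent z s * P.psi s (fun a => z ⟨s, a⟩ / G.atParent z s)) L Y ∧
      L (X - Y) = (G.ownReach x s - G.ownReach y s) * P.psi s (y s) +
        G.ownReach x s * ∑ a, P.gradPsi s (y s) a * (x s a - y s a) := by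
    intro s
    have hne : G.atParent Y s ≠ 0 := by rw [hatY]; exact (hy.ownReach_mem s).1.ne'
    have h1 : ∀ a, HasFDerivAt (fun z : (Σ s, A s) → ℝ => z ⟨s, a⟩ / G.atParent z s)
        (Y ⟨s, a⟩ • (-(G.atParent Y s ^ 2)⁻¹ • par s) + (G.atParent Y s)⁻¹ •
          ContinuousLinearMap.proj (R := ℝ) (φ := fun _ : (Σ s, A s) => ℝ) ⟨s, a⟩) Y := by
      intro a
      simp only [div_eq_mul_inv]
      exact (hasFDerivAt_apply (𝕜 := ℝ) (⟨s, a⟩ : Σ s, A s) Y).mul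
        ((hasDerivAt_inv hne).comp_hasFDerivAt Y (hpar s Y))
    have h2 := hasFDerivAt_pi.2 h1
    have hYs : (fun a => Y ⟨s, a⟩ / G.atParent Y s) = y s := by rw [hatY]; exact hquot hy s
    have h3 : HasFDerivAt (P.psi s) (dotCLM (P.gradPsi s (y s)))
        (fun a => Y ⟨s, a⟩ / G.atParent Y s) := by
      rw [hYs]; exact P.hasFDerivAt_psi (hy.pos s)
    have h4 : HasFDerivAt (fun z => P.psi s (fun a => z ⟨s, a⟩ / G.atParent z s)) _ Y :=
      HasFDerivAt.comp (g := P.psi s) Y h3 h2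
    refine ⟨_, (hpar s Y).mul h4, ?_⟩
    have h0 := (hy.ownReach_mem (G := G) s).1.ne'
    simp only [add_apply, smul_apply, ContinuousLinearMap.comp_apply, dotCLM_apply,
      ContinuousLinearMap.pi_apply, smul_eq_mul, hparsub, hatY,
      ContinuousLinearMap.proj_apply]
    rw [show (fun a => Y ⟨s, a⟩ / G.ownReach y s) = y s from hquot hy s, add_comm, Finset.mul_sum,
      Finset.mul_sum, mul_comm (P.psi s (y s))]
    congr 1
    refine Finset.sum_congr rfl fun a _ => ?_
    simp only [Pi.sub_apply, hX, hY, Game.seqForm]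
    field_simp
    ring
  choose L hL hLv using hderiv
  have hsum : HasFDerivAt (G.dilated P) (∑ s, L s) Y :=
    HasFDerivAt.fun_sum fun s _ => hL s
  rw [Game.divergence, bregman, ← hX, ← hY, hsum.fderiv]
  simp only [Game.dilated, hatX, hatY, sum_apply, hLv]
  rw [← Finset.sum_sub_distrib, ← Finset.sum_sub_distrib]
  refine Finset.sum_congr rfl fun s _ => ?_
  rw [hX, hY, hquot hx s, hquot hy s, P.bregman_psi_eq (hy.pos s)]
  ring

end

/-! ### Stability of consecutive iterates -/

section
variable {S : Type*} {A : S → Type*} {C : Type*} [Fintype C] [∀ s, Fintype (A s)] [Fintype S]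
  [Nonempty S] [∀ s, Nonempty (A s)]
  {G : Game S A C} {P : Params S A} {f : Feedback} {γ Q : ℝ} {η : S → ℝ}
  {h : Hist S A C} {s : S} {i : Fin 2} {x y : Profile S A} {π πbar q : ℕ → Profile S A} {T t : ℕ}

theorem Game.ancRate_nonneg (hη : ∀ s, 0 < η s) : 0 ≤ G.ancRate η s :=
  Real.iSup_nonneg fun s' => (hη s'.1).le

theorem Game.le_ancRate {s' : S} (hs : G.IsAncestor s' s) : η s' ≤ G.ancRate η s :=
  le_ciSup (f := fun s' : {s' // G.IsAncestor s' s} => η s') (Set.finite_range _).bddAbove ⟨s', hs⟩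

/-- The learning rates on the path of a player to `s` add up to at most twice the largest one:
condition (A) is applied at the last infoset of the player before `s`. -/
theorem RateConditions.sum_path_le (hr : RateConditions G P f γ Q η) (hh : h ∈ G.infoNodes s)
    (i : Fin 2) :
    ((personalMoves G.player i h).map fun p => η p.1).sum ≤ 2 * G.ancRate η s := by
  rcases hl : personalMoves G.player i h with _ | ⟨p, l⟩
  · simpa using G.ancRate_nonneg hr.pos
  · obtain ⟨h₀, h1, h2, -, h4⟩ :=
      G.exists_of_personalMoves_cons (G.mem_infoNodes.1 hh).1 hl
    have h5 := hr.condA p.1 i h₀ h1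
    have h6 : η p.1 ≤ G.ancRate η s :=
      G.le_ancRate ⟨h, hh, p.2, h2.subset List.mem_cons_self⟩
    rw [List.map_cons, List.sum_cons, h4]
    linarith

theorem feedbackBound_le (ht : t ≤ T) (s : S) (a : A s) : |q t s a| ≤ feedbackBound q T :=
  le_ciSup (f := fun x : Fin (T + 1) × (Σ s, A s) => |q x.1 x.2.1 x.2.2|)
    (Set.finite_range _).bddAbove (⟨t, by omega⟩, ⟨s, a⟩)

theorem feedbackBound_nonneg : 0 ≤ feedbackBound q T := Real.iSup_nonneg fun _ => abs_nonneg _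

theorem IsRun.feasible_bar (hrun : IsRun G P f η π πbar q) (ht : 1 ≤ t) : P.Feasible (πbar t) := by
  rcases ht.eq_or_lt with rfl | ht
  · exact hrun.init_feasible
  · obtain ⟨n, rfl⟩ : ∃ n, t = n + 1 := ⟨t - 1, by omega⟩
    exact fun s => (hrun.step_bar n (by omega) s).1

theorem IsRun.feasible (hrun : IsRun G P f η π πbar q) (t : ℕ) : P.Feasible (π t) := by
  rcases t.eq_zero_or_pos with rfl | ht
  · rw [hrun.init]; exact hrun.init_feasible
  · exact fun s => (hrun.step t ht s).1

/-- The weight of the regularizer in a proximal step at the profile `π`. -/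
noncomputable def Game.regCoeff (G : Game S A C) (P : Params S A) (f : Feedback) (π : Profile S A)
    (s : S) : ℝ := P.τ * G.oppReach π s / G.weight f π s

theorem Params.Feasible.regCoeff_nonneg (hx : P.Feasible x) : 0 ≤ G.regCoeff P f x s :=
  div_nonneg (mul_nonneg P.τ_pos.le (hx.oppReach_pos s).le) (hx.weight_pos f s).le

theorem IsRun.prox (hrun : IsRun G P f η π πbar q) (ht : 1 ≤ t) (s : S) :
    IsArgmin (P.proxObjective s (G.regCoeff P f (π (t - 1)) s) (η s) (q (t - 1) s) (πbar t s))
      (P.perturbedSimplex s) (π t s) := hrun.step t ht s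

theorem IsRun.prox_bar (hrun : IsRun G P f η π πbar q) (ht : 1 ≤ t) (s : S) :
    IsArgmin (P.proxObjective s (G.regCoeff P f (π t) s) (η s) (q t s) (πbar t s))
      (P.perturbedSimplex s) (πbar (t + 1) s) := hrun.step_bar t ht s

/-- Consecutive iterates are at most three proximal steps apart. -/
theorem IsRun.abs_sub_le (hγ : G.IsReachBound P γ) (hrun : IsRun G P f η π πbar q) {φ : ℝ → ℝ}
    {ε : S → ℝ} (hstep : ∀ s c (q y u : A s → ℝ),
      IsArgmin (P.proxObjective s c (η s) q y) (P.perturbedSimplex s) u →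
      y ∈ P.perturbedSimplex s → 0 ≤ c → c ≤ P.τ / G.M1 f γ → (∀ a, |q a| ≤ Q) →
      ∀ a, |φ (u a) - φ (y a)| ≤ ε s)
    (hq : ∀ t ≤ T, ∀ s a, |q t s a| ≤ Q) (ht : 1 ≤ t) (htT : t ≤ T) (s : S) (a : A s) :
    |φ (π t s a) - φ (π (t - 1) s a)| ≤ 3 * ε s := by
  have h1 : ∀ t, 1 ≤ t → t ≤ T → |φ (π t s a) - φ (πbar t s a)| ≤ ε s := fun t ht htT =>
    hstep s _ _ _ _ (hrun.prox ht s) (hrun.feasible_bar ht s) (hrun.feasible _).regCoeff_nonneg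
      (hγ.coeff_le (hrun.feasible _) f s) (hq _ (by omega) s) a
  have h2 : ∀ t, 1 ≤ t → t ≤ T → |φ (πbar (t + 1) s a) - φ (πbar t s a)| ≤ ε s := fun t ht htT =>
    hstep s _ _ _ _ (hrun.prox_bar ht s) (hrun.feasible_bar ht s) (hrun.feasible _).regCoeff_nonneg
      (hγ.coeff_le (hrun.feasible _) f s) (hq _ htT s) a
  have h3 := h1 t ht htT
  obtain ⟨n, rfl⟩ : ∃ n, t = n + 1 := ⟨t - 1, by omega⟩
  rcases n.eq_zero_or_pos with rfl | hn
  · have := (abs_nonneg _).trans h3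
    simp only [Nat.add_sub_cancel, hrun.init]
    linarith
  · have h4 := h1 n hn (by omega)
    have h5 := h2 n hn (by omega)
    rw [Nat.add_sub_cancel]
    rw [abs_le] at *
    constructor <;> linarith [h3.1, h3.2, h4.1, h4.2, h5.1, h5.2]

theorem abs_log_prod_sub_le (hx : P.Feasible x) (hy : P.Feasible y) {K : ℝ}
    (hxy : ∀ s a, |Real.log (x s a) - Real.log (y s a)| ≤ K * η s) (l : List (Σ s, A s)) :
    |Real.log (l.map fun p => x p.1 p.2).prod - Real.log (l.map fun p => y p.1 p.2).prod| ≤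
      K * (l.map fun p => η p.1).sum := by
  induction l with
  | nil => simp
  | cons p l ih =>
    simp only [List.map_cons, List.prod_cons, List.sum_cons]
    rw [Real.log_mul (hx.pos _ _).ne' (hx.prod_mem l).1.ne',
      Real.log_mul (hy.pos _ _).ne' (hy.prod_mem l).1.ne', mul_add]
    have := hxy p.1 p.2
    rw [abs_le] at *
    constructor <;> linarith [ih.1, ih.2, this.1, this.2]

theorem abs_prod_sub_le (hx : P.Feasible x) (hy : P.Feasible y) {K : ℝ}
    (hxy : ∀ s a, |x s a - y s a| ≤ K * η s) (l : List (Σ s, A s)) :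
    |(l.map fun p => x p.1 p.2).prod - (l.map fun p => y p.1 p.2).prod| ≤
      K * (l.map fun p => η p.1).sum := by
  induction l with
  | nil => simp
  | cons p l ih =>
    simp only [List.map_cons, List.prod_cons, List.sum_cons]
    set X := (l.map fun p => x p.1 p.2).prod
    set Y := (l.map fun p => y p.1 p.2).prod
    have hX := hx.prod_mem l
    have e : x p.1 p.2 * X - y p.1 p.2 * Y = (x p.1 p.2 - y p.1 p.2) * X + y p.1 p.2 * (X - Y) := by
      ring
    rw [e, mul_add]
    refine (abs_add_le _ _).trans (add_le_add ?_ ?_)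
    · rw [abs_mul, abs_of_pos hX.1]
      exact (mul_le_of_le_one_right (abs_nonneg _) hX.2).trans (hxy _ _)
    · rw [abs_mul, abs_of_pos (hy.pos _ _)]
      exact (mul_le_of_le_one_left (abs_nonneg _) (hy.le_one _ _)).trans ih

theorem log_one_div_nonneg (hγ : 0 < γ) (hγ1 : γ ≤ 1) : 0 ≤ Real.log (1 / γ) :=
  Real.log_nonneg ((one_le_div hγ).2 hγ1)

theorem Game.le_cEnt (s : S) :
    2 * Q / P.α s + P.τ / G.M1 f γ * Real.log (1 / γ) ≤ G.cEnt P f γ Q :=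
  le_ciSup (f := fun s => 2 * Q / P.α s + P.τ / G.M1 f γ * Real.log (1 / γ))
    (Set.finite_range _).bddAbove s

theorem Game.le_iSup_cDiff (s : S) : G.cDiff P f γ Q s ≤ ⨆ s, G.cDiff P f γ Q s :=
  le_ciSup (Set.finite_range _).bddAbove s

theorem Game.IsReachBound.cEnt_nonneg (hγ : G.IsReachBound P γ) (hx : P.Feasible x) (hQ : 0 ≤ Q) :
    0 ≤ G.cEnt P f γ Q := by
  have h1 := hγ.M1_pos f
  have h2 := P.τ_pos
  have h3 := log_one_div_nonneg hγ.1 (hγ.le_one hx)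
  refine Real.iSup_nonneg fun s => ?_
  have := P.α_pos s
  positivity

theorem Game.IsReachBound.cDiff_nonneg (hγ : G.IsReachBound P γ) (hx : P.Feasible x) (hQ : 0 ≤ Q)
    (s : S) : 0 ≤ G.cDiff P f γ Q s := by
  have h1 := hγ.M1_pos f
  have h2 := P.τ_pos
  have h3 := log_one_div_nonneg hγ.1 (hγ.le_one hx)
  have := P.α_pos s
  unfold Game.cDiff
  cases P.reg <;> simp only <;> positivity

theorem Game.IsReachBound.iSup_cDiff_nonneg (hγ : G.IsReachBound P γ) (hx : P.Feasible x)
    (hQ : 0 ≤ Q) : 0 ≤ ⨆ s, G.cDiff P f γ Q s :=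
  Real.iSup_nonneg fun s => hγ.cDiff_nonneg hx hQ s

theorem Game.IsReachBound.cMinus_nonneg (hγ : G.IsReachBound P γ) (hx : P.Feasible x) (hQ : 0 ≤ Q)
    (f' : Feedback) (s : S) : 0 ≤ G.cMinus P f γ Q f' s := by
  have h1 := hγ.iSup_cDiff_nonneg (f := f) hx hQ
  have h2 := hγ.cEnt_nonneg (f := f) hx hQ
  have h3 := hγ.1
  unfold Game.cMinus
  cases f' <;> cases P.reg <;> simp only <;> positivity

theorem Game.IsReachBound.cSlash_nonneg (hγ : G.IsReachBound P γ) (hx : P.Feasible x) (hQ : 0 ≤ Q)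
    (s : S) : 0 ≤ G.cSlash P f γ Q s := by
  have h1 := hγ.iSup_cDiff_nonneg (f := f) hx hQ
  have h2 := hγ.cEnt_nonneg (f := f) hx hQ
  have h3 := hγ.1
  have h4 := hγ.M1_pos f
  unfold Game.cSlash
  cases f <;> cases P.reg <;> simp only <;> positivity

/-- Reach probabilities change by a factor close to one under the entropy regularizer. -/
theorem IsRun.playerReach_stable_entropy (hγ : G.IsReachBound P γ)
    (hrun : IsRun G P f η π πbar q) (hr : RateConditions G P f γ (feedbackBound q T) η)
    (hreg : P.reg = .entropy) (ht : 1 ≤ t) (htT : t ≤ T) (hh : h ∈ G.infoNodes s) (i : Fin 2) :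
    |G.playerReach (π t) i h / G.playerReach (π (t - 1)) i h - 1| ≤
        12 * G.cEnt P f γ (feedbackBound q T) * G.ancRate η s ∧
    |G.playerReach (π (t - 1)) i h / G.playerReach (π t) i h - 1| ≤
        12 * G.cEnt P f γ (feedbackBound q T) * G.ancRate η s := by
  set Q := feedbackBound q T
  set E := G.cEnt P f γ Q with hE
  have hx := hrun.feasible t
  have hy := hrun.feasible (t - 1)
  have hE0 : 0 ≤ E := hγ.cEnt_nonneg hx feedbackBound_nonneg
  have h1 : ∀ s a, |Real.log (π t s a) - Real.log (π (t - 1) s a)| ≤ 3 * E * η s := by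
    intro s a
    refine (hrun.abs_sub_le hγ (ε := fun s => E * η s) ?_
      (fun t ht s a => feedbackBound_le ht s a) ht htT s a).trans_eq (mul_assoc _ _ _).symm
    intro s c q y u h1 h2 h3 h4 h5 a
    have h6 : ∀ a, γ ≤ u a := by
      intro a
      classical
      -- a feasible profile that plays `u` at `s`
      have hf : P.Feasible (Function.update (π 0) s u) := by
        intro s'
        rcases eq_or_ne s' s with rfl | hne
        · simpa using h1.1
        · rw [Function.update_of_ne hne]; exact hrun.feasible 0 s'
      simpa using hγ.le hf s a
    refine (P.prox_stable_entropy hreg h1 h2 (hr.pos s) h3 h5 hγ.1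
      (hγ.le_one hx) h6 a).trans ?_
    rw [mul_comm E]
    refine mul_le_mul_of_nonneg_left (le_trans ?_ (G.le_cEnt s)) (hr.pos s).le
    have := log_one_div_nonneg hγ.1 (hγ.le_one hx)
    gcongr
  have h2 := abs_log_prod_sub_le hx hy h1 (personalMoves G.player i h)
  have h3 := mul_le_mul_of_nonneg_left (hr.sum_path_le hh i) (show 0 ≤ 3 * E by positivity)
  have h4 := h2.trans h3
  have h5 := hr.condB s
  have e : 3 * E * (2 * G.ancRate η s) = 6 * G.ancRate η s * E := by ring
  have hX := (hx.playerReach_mem (G := G) (i := i) (h := h)).1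
  have hY := (hy.playerReach_mem (G := G) (i := i) (h := h)).1
  change |Real.log (G.playerReach (π t) i h) - Real.log (G.playerReach (π (t - 1)) i h)| ≤ _ at h4
  rw [e] at h4
  have e2 : 2 * (6 * G.ancRate η s * E) = 12 * E * G.ancRate η s := by ring
  constructor
  · have h6 := Real.abs_exp_sub_one_le (h4.trans h5)
    rw [Real.exp_sub, Real.exp_log hX, Real.exp_log hY] at h6
    linarith
  · rw [abs_sub_comm] at h4
    have h6 := Real.abs_exp_sub_one_le (h4.trans h5)
    rw [Real.exp_sub, Real.exp_log hX, Real.exp_log hY] at h6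
    linarith

/-- Reach probabilities change little under the Euclidean regularizer. -/
theorem IsRun.playerReach_stable_euclidean (hγ : G.IsReachBound P γ)
    (hrun : IsRun G P f η π πbar q) (hr : RateConditions G P f γ (feedbackBound q T) η)
    (hreg : P.reg = .euclidean) (ht : 1 ≤ t) (htT : t ≤ T) (hh : h ∈ G.infoNodes s) (i : Fin 2) :
    |G.playerReach (π t) i h - G.playerReach (π (t - 1)) i h| ≤
        6 * (⨆ s, G.cDiff P f γ (feedbackBound q T) s) * G.ancRate η s := by
  set Q := feedbackBound q T
  set F := ⨆ s, G.cDiff P f γ Q s with hF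
  have hx := hrun.feasible t
  have hy := hrun.feasible (t - 1)
  have hF0 : 0 ≤ F := hγ.iSup_cDiff_nonneg hx feedbackBound_nonneg
  have h1 : ∀ s a, |π t s a - π (t - 1) s a| ≤ 3 * F * η s := by
    intro s a
    refine (hrun.abs_sub_le hγ (φ := id) (ε := fun s => F * η s) ?_
      (fun t ht s a => feedbackBound_le ht s a) ht htT s a).trans_eq (mul_assoc _ _ _).symm
    intro s c q y u h1 h2 h3 h4 h5 a
    refine (P.prox_stable_euclidean hreg h1 h2 (hr.pos s) h3 h5 a).trans ?_
    rw [mul_comm F]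
    refine mul_le_mul_of_nonneg_left (le_trans ?_ (G.le_iSup_cDiff s)) (hr.pos s).le
    simp only [Game.cDiff, hreg]
    gcongr
  have h2 := abs_prod_sub_le hx hy h1 (personalMoves G.player i h)
  have h3 := mul_le_mul_of_nonneg_left (hr.sum_path_le hh i) (show 0 ≤ 3 * F by positivity)
  exact (h2.trans h3).trans_eq (by ring)

theorem IsRun.ownReach_stable_entropy (hγ : G.IsReachBound P γ)
    (hrun : IsRun G P f η π πbar q) (hr : RateConditions G P f γ (feedbackBound q T) η)
    (hreg : P.reg = .entropy) (ht : 1 ≤ t) (htT : t ≤ T) (s : S) :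
    |G.ownReach (π (t - 1)) s / G.ownReach (π t) s - 1| ≤
        12 * G.cEnt P f γ (feedbackBound q T) * G.ancRate η s := by
  obtain ⟨h, hh⟩ := G.infoNodes_nonempty s
  have := (hrun.playerReach_stable_entropy hγ hr hreg ht htT hh (G.player s)).2
  rwa [G.playerReach_eq_ownReach hh, G.playerReach_eq_ownReach hh] at this

theorem IsRun.ownReach_stable_euclidean (hγ : G.IsReachBound P γ)
    (hrun : IsRun G P f η π πbar q) (hr : RateConditions G P f γ (feedbackBound q T) η)
    (hreg : P.reg = .euclidean) (ht : 1 ≤ t) (htT : t ≤ T) (s : S) :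
    |G.ownReach (π t) s - G.ownReach (π (t - 1)) s| ≤
        6 * (⨆ s, G.cDiff P f γ (feedbackBound q T) s) * G.ancRate η s := by
  obtain ⟨h, hh⟩ := G.infoNodes_nonempty s
  have := hrun.playerReach_stable_euclidean hγ hr hreg ht htT hh (G.player s)
  rwa [G.playerReach_eq_ownReach hh, G.playerReach_eq_ownReach hh] at this

theorem IsRun.oppReach_stable (hγ : G.IsReachBound P γ)
    (hrun : IsRun G P f η π πbar q) (hr : RateConditions G P f γ (feedbackBound q T) η)
    (ht : 1 ≤ t) (htT : t ≤ T) (s : S) :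
    |G.oppReach (π t) s - G.oppReach (π (t - 1)) s| ≤
      G.cMinus P f γ (feedbackBound q T) .qValue s * G.ancRate η s := by
  have hx := hrun.feasible t
  have hy := hrun.feasible (t - 1)
  have h0 : |G.oppReach (π t) s - G.oppReach (π (t - 1)) s| ≤
      ∑ h ∈ G.infoNodes s, G.chanceReach h * |G.playerReach (π t) (1 - G.player s) h -
        G.playerReach (π (t - 1)) (1 - G.player s) h| := by
    rw [Game.oppReach, Game.oppReach, ← Finset.sum_sub_distrib]
    refine (Finset.abs_sum_le_sum_abs _ _).trans_eq (Finset.sum_congr rfl fun h hh => ?_)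
    rw [← mul_sub, abs_mul, abs_of_pos (G.chanceReach_pos (G.mem_infoNodes.1 hh).1)]
  refine h0.trans ?_
  rcases hreg : P.reg with _ | _
  · simp only [Game.cMinus, hreg]
    set K := 12 * G.cEnt P f γ (feedbackBound q T) * G.ancRate η s with hK
    have hK0 : 0 ≤ K := mul_nonneg (mul_nonneg (by norm_num)
      (hγ.cEnt_nonneg hx feedbackBound_nonneg)) (G.ancRate_nonneg hr.pos)
    have h1 : ∀ h ∈ G.infoNodes s, G.chanceReach h * |G.playerReach (π t) (1 - G.player s) h -
        G.playerReach (π (t - 1)) (1 - G.player s) h| ≤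
        K * (G.chanceReach h * G.playerReach (π (t - 1)) (1 - G.player s) h) := by
      intro h hh
      have h2 := (hrun.playerReach_stable_entropy hγ hr hreg ht htT hh (1 - G.player s)).1
      have hY := (hy.playerReach_mem (G := G) (i := 1 - G.player s) (h := h)).1
      rw [div_sub_one hY.ne', abs_div, abs_of_pos hY, div_le_iff₀ hY] at h2
      calc _ ≤ G.chanceReach h * (K * G.playerReach (π (t - 1)) (1 - G.player s) h) :=
            mul_le_mul_of_nonneg_left h2 (G.chanceReach_pos (G.mem_infoNodes.1 hh).1).le
        _ = _ := by ring
    calc _ ≤ K * G.oppReach (π (t - 1)) s := by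
          rw [Game.oppReach, Finset.mul_sum]; exact Finset.sum_le_sum h1
      _ ≤ K := mul_le_of_le_one_right hK0 (hy.oppReach_le_one s)
  · simp only [Game.cMinus, hreg]
    set K := 6 * (⨆ s, G.cDiff P f γ (feedbackBound q T) s) * G.ancRate η s with hK
    have h1 : ∀ h ∈ G.infoNodes s, G.chanceReach h * |G.playerReach (π t) (1 - G.player s) h -
        G.playerReach (π (t - 1)) (1 - G.player s) h| ≤ K := by
      intro h hh
      have h2 := hrun.playerReach_stable_euclidean hγ hr hreg ht htT hh (1 - G.player s)
      exact (mul_le_of_le_one_left (abs_nonneg _)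
        (G.chanceReach_le_one (G.mem_infoNodes.1 hh).1)).trans h2
    refine (Finset.sum_le_sum h1).trans_eq ?_
    rw [Finset.sum_const, nsmul_eq_mul, hK]
    ring

/-- Additive stability of the factors `m_s`. -/
theorem IsRun.weight_stable (hγ : G.IsReachBound P γ)
    (hrun : IsRun G P f η π πbar q) (hr : RateConditions G P f γ (feedbackBound q T) η)
    (ht : 1 ≤ t) (htT : t ≤ T) (s : S) :
    |G.weight f (π t) s - G.weight f (π (t - 1)) s| ≤
      G.cMinus P f γ (feedbackBound q T) f s * G.ancRate η s := by
  have hx := hrun.feasible t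
  have hy := hrun.feasible (t - 1)
  have hγ0 := hγ.1
  rcases f with _ | _ | _
  · simp [Game.weight, Game.cMinus]
  · have hX := (hx.ownReach_mem (G := G) s).1
    have hY := (hy.ownReach_mem (G := G) s).1
    have hXγ := hγ.le_ownReach hx s
    have hYγ := hγ.le_ownReach hy s
    simp only [Game.weight]
    rcases hreg : P.reg with _ | _
    · have h1 := hrun.ownReach_stable_entropy hγ hr hreg ht htT s
      simp only [Game.cMinus, hreg]
      set K := G.cEnt P .trajectoryQ γ (feedbackBound q T)
      have e : 1 / G.ownReach (π t) s - 1 / G.ownReach (π (t - 1)) s =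
          (G.ownReach (π (t - 1)) s / G.ownReach (π t) s - 1) / G.ownReach (π (t - 1)) s := by
        field_simp
      rw [e, abs_div, abs_of_pos hY]
      calc _ ≤ 12 * K * G.ancRate η s / γ :=
            div_le_div₀ ((abs_nonneg _).trans h1) h1 hγ0 hYγ
        _ = _ := by ring
    · have h1 := hrun.ownReach_stable_euclidean hγ hr hreg ht htT s
      simp only [Game.cMinus, hreg]
      set K := ⨆ s, G.cDiff P .trajectoryQ γ (feedbackBound q T) s
      have e : 1 / G.ownReach (π t) s - 1 / G.ownReach (π (t - 1)) s =
          (G.ownReach (π (t - 1)) s - G.ownReach (π t) s) /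
            (G.ownReach (π t) s * G.ownReach (π (t - 1)) s) := by
        field_simp
      rw [e, abs_div, abs_of_pos (mul_pos hX hY), abs_sub_comm]
      calc _ ≤ 6 * K * G.ancRate η s / γ ^ 2 := by
            refine div_le_div₀ ((abs_nonneg _).trans h1) h1 (by positivity) ?_
            rw [pow_two]
            exact mul_le_mul hXγ hYγ hγ0.le hX.le
        _ = _ := by ring
  · exact hrun.oppReach_stable hγ hr ht htT s

/-- Stability of the regularization weights of the proximal steps. -/
theorem IsRun.regCoeff_stable (hγ : G.IsReachBound P γ)
    (hrun : IsRun G P f η π πbar q) (hr : RateConditions G P f γ (feedbackBound q T) η)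
    (ht : 1 ≤ t) (htT : t ≤ T) (s : S) :
    G.weight f (π t) s * |G.regCoeff P f (π t) s - G.regCoeff P f (π (t - 1)) s| ≤
      P.τ * ((G.cSlash P f γ (feedbackBound q T) s +
        G.cMinus P f γ (feedbackBound q T) .qValue s) * G.ancRate η s) := by
  have hx := hrun.feasible t
  have hy := hrun.feasible (t - 1)
  have hγ0 := hγ.1
  have hτ := P.τ_pos
  have hQ : 0 ≤ feedbackBound q T := feedbackBound_nonneg
  have hanc : 0 ≤ G.ancRate η s := G.ancRate_nonneg hr.pos
  have hopp := hrun.oppReach_stable hγ hr ht htT s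
  have hpx := hx.oppReach_pos (G := G) s
  have hpy := hy.oppReach_pos (G := G) s
  have hw : ∀ z : Profile S A, G.regCoeff P f z s = P.τ * (G.oppReach z s / G.weight f z s) :=
    fun z => mul_div_assoc _ _ _
  rw [hw, hw, ← mul_sub, abs_mul, abs_of_pos hτ, mul_left_comm]
  refine mul_le_mul_of_nonneg_left ?_ hτ.le
  have hS := hγ.cSlash_nonneg (f := f) hx hQ s
  rcases f with _ | _ | _
  · simp only [Game.weight, Game.cSlash, div_one, one_mul, zero_add]
    exact hopp
  · have hX := (hx.ownReach_mem (G := G) s).1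
    have hY := (hy.ownReach_mem (G := G) s).1
    have hXγ := hγ.le_ownReach hx s
    simp only [Game.weight]
    have e : G.oppReach (π t) s / (1 / G.ownReach (π t) s) -
        G.oppReach (π (t - 1)) s / (1 / G.ownReach (π (t - 1)) s) =
        G.ownReach (π t) s * ((G.oppReach (π t) s - G.oppReach (π (t - 1)) s) +
          G.oppReach (π (t - 1)) s * (1 - G.ownReach (π (t - 1)) s / G.ownReach (π t) s)) := by
      field_simp
      ring
    rw [e, abs_mul, abs_of_pos hX, ← mul_assoc, one_div_mul_cancel hX.ne', one_mul]
    refine (abs_add_le _ _).trans ?_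
    rw [add_mul, add_comm (_ * G.ancRate η s)]
    refine add_le_add hopp ?_
    rw [abs_mul, abs_of_pos hpy]
    refine (mul_le_of_le_one_left (abs_nonneg _) (hy.oppReach_le_one s)).trans ?_
    rw [abs_sub_comm]
    rcases hreg : P.reg with _ | _
    · simp only [Game.cSlash, hreg]
      exact hrun.ownReach_stable_entropy hγ hr hreg ht htT s
    · simp only [Game.cSlash, hreg, Game.M1, mul_one]
      have h1 := hrun.ownReach_stable_euclidean hγ hr hreg ht htT s
      set K := ⨆ s, G.cDiff P .trajectoryQ γ (feedbackBound q T) s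
      have h0 := (abs_nonneg _).trans h1
      rw [div_sub_one hX.ne', abs_div, abs_of_pos hX, abs_sub_comm]
      calc _ ≤ 6 * K * G.ancRate η s / γ ^ 2 := by
            refine div_le_div₀ h0 h1 (by positivity) ?_
            have := hγ.le_one hx
            nlinarith
        _ = _ := by ring
  · simp only [Game.weight]
    rw [div_self hpx.ne', div_self hpy.ne', sub_self, abs_zero, mul_zero]
    exact mul_nonneg (add_nonneg hS (hγ.cMinus_nonneg hx hQ _ s)) hanc

end

/-! ### The explicit bound -/

section
variable {S : Type*} {A : S → Type*} {C : Type*} [Fintype C] [∀ s, Fintype (A s)] [Fintype S]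
  [Nonempty S] [∀ s, Nonempty (A s)]
  {G : Game S A C} {P : Params S A} {f : Feedback} {γ Q : ℝ} {η : S → ℝ}
  {s : S} {x y : Profile S A} {π πbar q : ℕ → Profile S A} {T t : ℕ}

/-- The gap between the feedback that `π^t` anticipates and the one that it receives costs at most
`2 C^diff ‖q‖ η`, once the divergence between the two proximal steps is used. -/
theorem Game.IsReachBound.sum_sub_mul_le (hγ : G.IsReachBound P γ) (hx : P.Feasible x)
    {u v d : A s → ℝ} {ε : ℝ} (hu : u ∈ P.perturbedSimplex s) (hv : v ∈ P.perturbedSimplex s)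
    (hε : 0 < ε) (hQ : 0 ≤ Q) (hd : ∀ a, |d a| ≤ 2 * Q) :
    ∑ a, (u a - v a) * d a - 1 / ε * bregman (P.psi s) u v ≤ 2 * G.cDiff P f γ Q s * Q * ε := by
  have hα := P.α_pos s
  have h1 := hγ.M1_pos f
  have h2 := P.τ_pos
  have h3 := log_one_div_nonneg hγ.1 (hγ.le_one hx)
  rcases hreg : P.reg with _ | _
  · refine (P.sum_sub_mul_le_entropy hreg hε (P.pos_of_mem hu) (P.pos_of_mem hv) hu.1.2 hv.1.2
      hd).trans ?_
    simp only [Game.cDiff, hreg]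
    calc 4 * Q ^ 2 * ε / P.α s = 2 * (2 / P.α s * (Q + 0)) * Q * ε := by ring
      _ ≤ _ := by gcongr; positivity
  · refine (P.sum_sub_mul_le_euclidean hreg hε (P.pos_of_mem hv) hd).trans ?_
    simp only [Game.cDiff, hreg]
    calc 2 * (Fintype.card (A s) : ℝ) * Q ^ 2 * ε / P.α s =
          2 * (Fintype.card (A s) / P.α s * Q + 0) * Q * ε := by ring
      _ ≤ _ := by gcongr; positivity

theorem Params.Feasible.weight_mul_regCoeff (hx : P.Feasible x) :
    G.weight f x s * G.regCoeff P f x s = P.τ * G.oppReach x s :=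
  mul_div_cancel₀ _ (hx.weight_pos f s).ne'

/-- The local regret of one round. -/
theorem IsRun.localRegret_le (hγ : G.IsReachBound P γ)
    (hrun : IsRun G P f η π πbar q) (hr : RateConditions G P f γ (feedbackBound q T) η)
    (ht : 1 ≤ t) (htT : t ≤ T) {u : A s → ℝ} (hu : u ∈ P.perturbedSimplex s) :
    G.localRegret P (π t) s u ≤
      G.weight f (π t) s / η s * bregman (P.psi s) u (πbar t s) -
      (P.τ * G.oppReach (π t) s + G.weight f (π t) s / η s) *
        bregman (P.psi s) u (πbar (t + 1) s) +
      2 * G.cDiff P f γ (feedbackBound q T) s * feedbackBound q T * η s * M2 f γ +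
      P.τ * ((G.cSlash P f γ (feedbackBound q T) s +
        G.cMinus P f γ (feedbackBound q T) .qValue s) * G.ancRate η s) *
        |P.psi s (π t s) - P.psi s (πbar (t + 1) s)| := by
  set Q' := feedbackBound q T
  have hQ : 0 ≤ Q' := feedbackBound_nonneg
  have hx := hrun.feasible t
  have hy := hrun.feasible_bar ht
  have hb := hrun.feasible_bar (t := t + 1) (by omega)
  have hη := hr.pos s
  have hm := hx.weight_pos (G := G) f s
  have h1 := P.prox_three_point (hrun.prox_bar ht s) (hy.pos s) hu
  have h2 := P.prox_three_point (hrun.prox ht s) (hy.pos s) (hb s)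
  have h3 := hγ.sum_sub_mul_le (f := f) hx (hb s) (hx s) (d := fun a => q t s a - q (t - 1) s a)
    hη hQ (fun a => by
      have h4 : |q t s a| ≤ Q' := feedbackBound_le htT s a
      have h5 : |q (t - 1) s a| ≤ Q' := feedbackBound_le (by omega) s a
      have := abs_sub (q t s a) (q (t - 1) s a)
      linarith)
  have h4 := hrun.regCoeff_stable hγ hr ht htT s
  have h5 := hγ.weight_le hx f s
  have h6 := hγ.cDiff_nonneg (f := f) hx hQ s
  have hcf : G.localRegret P (π t) s u = G.weight f (π t) s *
      (∑ a, (u a - π t s a) * q t s a +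
        G.regCoeff P f (π t) s * (P.psi s (π t s) - P.psi s u)) := by
    rw [Game.localRegret, mul_add, ← mul_assoc, hx.weight_mul_regCoeff, Finset.mul_sum]
    congr 1
    refine Finset.sum_congr rfl fun a _ => ?_
    rw [← hx.weight_mul_feedback f, hrun.feedback_eq t ht]
    ring
  have hD1 := P.bregman_nonneg (s := s) (hx.pos s) (hy.pos s)
  have hD2 := P.bregman_nonneg (s := s) (hb.pos s) (hx.pos s)
  have hc' := (hrun.feasible (t - 1)).regCoeff_nonneg (G := G) (f := f) (s := s)
  set c := G.regCoeff P f (π t) s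
  set c' := G.regCoeff P f (π (t - 1)) s
  set m := G.weight f (π t) s
  set Dx := bregman (P.psi s) (π t s) (πbar t s)
  set Dbx := bregman (P.psi s) (πbar (t + 1) s) (π t s)
  set Δ := P.psi s (π t s) - P.psi s (πbar (t + 1) s) with hΔ
  have hsum : ∑ a, (u a - π t s a) * q t s a =
      ∑ a, (u a - πbar (t + 1) s a) * q t s a +
      ∑ a, (πbar (t + 1) s a - π t s a) * q (t - 1) s a +
      ∑ a, (πbar (t + 1) s a - π t s a) * (q t s a - q (t - 1) s a) := by
    rw [← Finset.sum_add_distrib, ← Finset.sum_add_distrib]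
    exact Finset.sum_congr rfl fun a _ => by ring
  have h7 : (c - c') * Δ ≤ |c - c'| * |Δ| := (le_abs_self _).trans_eq (abs_mul _ _)
  have h8 : 0 ≤ 1 / η s * Dx := by positivity
  have h9 : 0 ≤ c' * Dbx := mul_nonneg hc' hD2
  have key : ∑ a, (u a - π t s a) * q t s a + c * (P.psi s (π t s) - P.psi s u) ≤
      1 / η s * bregman (P.psi s) u (πbar t s) -
        (c + 1 / η s) * bregman (P.psi s) u (πbar (t + 1) s) +
      2 * G.cDiff P f γ Q' s * Q' * η s + |c - c'| * |Δ| := by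
    rw [hsum]
    have e : c * (P.psi s (π t s) - P.psi s u) =
      c * (P.psi s (πbar (t + 1) s) - P.psi s u) + c' * Δ + (c - c') * Δ := by
        rw [hΔ]; ring
    rw [e]
    linarith
  rw [hcf]
  have h10 := mul_le_mul_of_nonneg_left key hm.le
  have h11 : m * (2 * G.cDiff P f γ Q' s * Q' * η s) ≤
      2 * G.cDiff P f γ Q' s * Q' * η s * M2 f γ := by
    rw [mul_comm]
    exact mul_le_mul_of_nonneg_left h5 (by positivity)
  have h12 := mul_le_mul_of_nonneg_right h4 (abs_nonneg Δ)
  rw [← hx.weight_mul_regCoeff (G := G) (f := f) (s := s)]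
  refine h10.trans ?_
  rw [mul_add, mul_add, mul_sub, ← mul_assoc, ← mul_assoc m, ← mul_assoc m |c - c'|, mul_add m c,
    mul_one_div]
  linarith

/-- A telescoping sum with a surplus of `κ` per step. -/
theorem sum_telescope_le {a b D : ℕ → ℝ} {κ : ℝ} (ha : 0 ≤ a 1) (hab : ∀ t, 1 ≤ t → 0 ≤ b t + a t)
    (hD : ∀ t, 1 ≤ t → 0 ≤ D t)
    (h : ∀ t, 1 ≤ t → t + 1 ≤ T → a (t + 1) + κ ≤ b t + a t) :
    ∑ t ∈ Finset.Icc 1 T, (a t * D t - (b t + a t) * D (t + 1)) + κ * ∑ t ∈ Finset.Icc 2 T, D t ≤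
      a 1 * D 1 := by
  have key : ∀ n, n + 1 ≤ T →
      ∑ t ∈ Finset.Icc 1 (n + 1), (a t * D t - (b t + a t) * D (t + 1)) +
        κ * ∑ t ∈ Finset.Icc 2 (n + 1), D t + (b (n + 1) + a (n + 1)) * D (n + 2) ≤
      a 1 * D 1 := by
    intro n
    induction n with
    | zero => intro _; simp
    | succ n ih =>
      intro hn
      have h1 := ih (by omega)
      have h2 := mul_le_mul_of_nonneg_right (h (n + 1) (by omega) hn) (hD (n + 2) (by omega))
      rw [Finset.sum_Icc_succ_top (show 1 ≤ n + 1 + 1 by omega),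
        Finset.sum_Icc_succ_top (show 2 ≤ n + 1 + 1 by omega)]
      simp only [add_assoc, Nat.reduceAdd] at h1 h2 ⊢
      linarith
  rcases T.eq_zero_or_pos with rfl | hT
  · simpa using mul_nonneg ha (hD 1 le_rfl)
  · obtain ⟨n, rfl⟩ : ∃ n, T = n + 1 := ⟨T - 1, by omega⟩
    have := mul_nonneg (hab (n + 1) (by omega)) (hD (n + 2) (by omega))
    linarith [key n le_rfl]

/-- The regularizer pays for the drift of the factors `m_s`: their change per round is at most half
of the strong convexity gained in that round. -/
theorem IsRun.weight_div_add_le (hγ : G.IsReachBound P γ)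
    (hrun : IsRun G P f η π πbar q) (hr : RateConditions G P f γ (feedbackBound q T) η)
    (ht : 1 ≤ t) (htT : t + 1 ≤ T) (s : S) :
    G.weight f (π (t + 1)) s / η s + P.τ * γ * (⨅ s, G.chanceMass s) / 2 ≤
      P.τ * G.oppReach (π t) s + G.weight f (π t) s / η s := by
  have hη := hr.pos s
  have h1 := (le_abs_self _).trans (hrun.weight_stable hγ hr (t := t + 1) (by omega) htT s)
  rw [Nat.add_sub_cancel] at h1
  have h2 := hr.ratio s
  have h3 := hγ.le_oppReach (hrun.feasible t) s
  have h4 := G.iInf_chanceMass_le s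
  have hτ := P.τ_pos
  have h5 : (G.weight f (π (t + 1)) s - G.weight f (π t) s) / η s ≤
      P.τ * (γ / 2 * G.chanceMass s) := by
    refine (div_le_div_of_nonneg_right h1 hη.le).trans ?_
    rwa [mul_div_assoc]
  rw [sub_div] at h5
  have h6 := mul_le_mul_of_nonneg_left h3 hτ.le
  have h7 := mul_le_mul_of_nonneg_left h4 (mul_pos hτ hγ.1).le
  linarith

theorem IsRun.sum_divergence_le (hγ : G.IsReachBound P γ) (hx : G.IsRegularizedNash P x)
    (hrun : IsRun G P f η π πbar q) (hr : RateConditions G P f γ (feedbackBound q T) η) :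
    ∑ t ∈ Finset.Icc 2 T, G.divergence P x (πbar t) ≤ G.explicitBound P f γ η π πbar q x T := by
  set Q' := feedbackBound q T
  set w := ⨅ s, G.chanceMass s with hw
  have hw0 : 0 < w := G.iInf_chanceMass_pos
  have hτ := P.τ_pos
  have hγ0 := hγ.1
  set κ := P.τ * γ * w / 2 with hκ
  have hκ0 : 0 < κ := by positivity
  set X : S → ℝ := fun s => (G.cSlash P f γ Q' s + G.cMinus P f γ Q' .qValue s) * G.ancRate η s
  set Y : S → ℝ := fun s => 2 * G.cDiff P f γ Q' s * Q' * η s * M2 f γ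
  set D : S → ℕ → ℝ := fun s t => bregman (P.psi s) (x s) (πbar t s)
  set Z : S → ℝ := fun s => ∑ t ∈ Finset.Icc 1 T, |P.psi s (π t s) - P.psi s (πbar (t + 1) s)|
  have hD : ∀ s t, 1 ≤ t → 0 ≤ D s t := fun s t ht =>
    P.bregman_nonneg (hx.1.pos s) ((hrun.feasible_bar ht).pos s)
  have hwt : ∀ s t, 0 ≤ G.weight f (π t) s / η s := fun s t =>
    div_nonneg ((hrun.feasible t).weight_pos f s).le (hr.pos s).le
  have hloc : ∀ s, ∑ t ∈ Finset.Icc 1 T, G.localRegret P (π t) s (x s) +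
      κ * ∑ t ∈ Finset.Icc 2 T, D s t ≤
      G.weight f (π 1) s / η s * D s 1 + T * Y s + P.τ * X s * Z s := by
    intro s
    have h1 := sum_telescope_le (T := T) (κ := κ) (a := fun t => G.weight f (π t) s / η s)
      (b := fun t => P.τ * G.oppReach (π t) s) (D := D s) (hwt s 1)
      (fun t _ => add_nonneg (mul_nonneg hτ.le ((hrun.feasible t).oppReach_pos s).le) (hwt s t))
      (hD s) (fun t ht htT => hrun.weight_div_add_le hγ hr ht htT s)
    have h2 : ∑ t ∈ Finset.Icc 1 T, G.localRegret P (π t) s (x s) ≤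
        ∑ t ∈ Finset.Icc 1 T, ((G.weight f (π t) s / η s * D s t -
          (P.τ * G.oppReach (π t) s + G.weight f (π t) s / η s) * D s (t + 1)) + Y s +
          P.τ * X s * |P.psi s (π t s) - P.psi s (πbar (t + 1) s)|) :=
      Finset.sum_le_sum fun t ht =>
        hrun.localRegret_le hγ hr (Finset.mem_Icc.1 ht).1 (Finset.mem_Icc.1 ht).2 (hx.1 s)
    have e : ∑ t ∈ Finset.Icc 1 T, P.τ * X s * |P.psi s (π t s) - P.psi s (πbar (t + 1) s)| =
        P.τ * X s * Z s := (Finset.mul_sum _ _ _).symm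
    rw [Finset.sum_add_distrib, Finset.sum_add_distrib, e, Finset.sum_const,
      Nat.card_Icc, Nat.add_sub_cancel, nsmul_eq_mul] at h2
    linarith
  have hreg : 0 ≤ ∑ s, G.ownReach x s * ∑ t ∈ Finset.Icc 1 T, G.localRegret P (π t) s (x s) := by
    simp only [Finset.mul_sum]
    rw [Finset.sum_comm]
    exact Finset.sum_nonneg fun t _ => hx.sum_localRegret_nonneg (hrun.feasible t)
  have hdiv : ∑ t ∈ Finset.Icc 2 T, G.divergence P x (πbar t) =
      ∑ s, G.ownReach x s * ∑ t ∈ Finset.Icc 2 T, D s t := by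
    simp only [Finset.mul_sum]
    rw [Finset.sum_comm]
    exact Finset.sum_congr rfl fun t ht =>
      G.divergence_eq hx.1 (hrun.feasible_bar (by have := (Finset.mem_Icc.1 ht).1; omega))
  have hall : κ * ∑ t ∈ Finset.Icc 2 T, G.divergence P x (πbar t) ≤
      ∑ s, G.ownReach x s * (G.weight f (π 1) s / η s * D s 1 + T * Y s + P.τ * X s * Z s) := by
    have h1 := Finset.sum_le_sum fun s (_ : s ∈ Finset.univ) =>
      mul_le_mul_of_nonneg_left (hloc s) (hx.1.ownReach_mem (G := G) s).1.le
    simp only [mul_add (G.ownReach x _) (∑ t ∈ Finset.Icc 1 T, _), Finset.sum_add_distrib] at h1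
    have e : ∑ s, G.ownReach x s * (κ * ∑ t ∈ Finset.Icc 2 T, D s t) =
        κ * ∑ t ∈ Finset.Icc 2 T, G.divergence P x (πbar t) := by
      rw [hdiv, Finset.mul_sum]
      exact Finset.sum_congr rfl fun s _ => by ring
    linarith
  rw [← le_div_iff₀' hκ0] at hall
  refine hall.trans_eq ?_
  rw [Game.explicitBound, ← hw, div_eq_inv_mul, Finset.mul_sum, Finset.mul_sum, Finset.mul_sum,
    Finset.mul_sum, ← Finset.sum_add_distrib, ← Finset.sum_add_distrib]
  refine Finset.sum_congr rfl fun s _ => ?_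
  have hη := (hr.pos s).ne'
  rw [show feedbackBound q T = Q' from rfl]
  simp only [X, Y, Z, D, hκ]
  field_simp
  ring

end

/-! ### Uniform constants -/

section
variable {S : Type*} {A : S → Type*} {C : Type*} [Fintype C] [∀ s, Fintype (A s)] [Fintype S]
  [Nonempty S] [∀ s, Nonempty (A s)]
  {G : Game S A C} {P : Params S A} {f : Feedback} {γ Q Q' : ℝ} {η : S → ℝ}
  {s : S} {x y : Profile S A} {π πbar q : ℕ → Profile S A} {T t : ℕ}

theorem Params.feasible_ν (P : Params S A) : P.Feasible P.ν := fun s =>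
  ⟨P.ν_mem s, fun a => mul_le_of_le_one_left (P.ν_pos s a).le (P.expl_mem s).2⟩

theorem Params.exists_psi_bound (P : Params S A) (s : S) :
    ∃ B, ∀ u ∈ P.perturbedSimplex s, |P.psi s u| ≤ B := by
  have hc : Continuous (P.psi s) := by
    have := Real.continuous_mul_log
    unfold Params.psi
    cases P.reg
    · exact continuous_const.mul (continuous_const.add (continuous_finsetSum _ fun a _ =>
        this.comp (continuous_apply a)))
    · fun_prop
  obtain ⟨B, hB⟩ := (isCompact_stdSimplex ℝ (A s)).exists_bound_of_continuousOn hc.continuousOn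
  exact ⟨B, fun u hu => hB u hu.1⟩

theorem Game.IsReachBound.exists_cfValue_bound (hγ : G.IsReachBound P γ) :
    ∃ B, ∀ π, P.Feasible π → ∀ s a, |G.cfValue P π s a| ≤ B := by
  choose B hB using P.exists_psi_bound
  have hB0 : ∀ s, 0 ≤ B s := fun s => (abs_nonneg _).trans (hB s _ (P.feasible_ν s))
  set R := 1 + P.τ * ∑ s, B s with hR
  have hR1 : 0 ≤ P.τ * ∑ s, B s := mul_nonneg P.τ_pos.le (Finset.sum_nonneg fun s _ => hB0 s)
  have hreward : ∀ π, P.Feasible π → ∀ i, ∀ h ∈ G.nodes, |G.nodeReward P π i h| ≤ R := by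
    intro π hπ i h hh
    unfold Game.nodeReward
    rcases ht : G.turn h with _ | _ | s
    · have := abs_le.2 (G.payoff_mem h hh ht)
      simp only
      split_ifs
      · linarith
      · rw [abs_neg]; linarith
    · simp only [abs_zero]; linarith
    · have h1 : |P.τ * P.psi s (π s)| ≤ P.τ * ∑ s, B s := by
        rw [abs_mul, abs_of_pos P.τ_pos]
        exact mul_le_mul_of_nonneg_left ((hB s _ (hπ s)).trans
          (Finset.single_le_sum (fun s _ => hB0 s) (Finset.mem_univ s))) P.τ_pos.le
      simp only
      split_ifs
      · rw [abs_neg]; linarith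
      · linarith
  refine ⟨G.nodes.card * (1 / γ * R), fun π hπ s a => ?_⟩
  have hterm : ∀ h ∈ G.below s a, |G.chanceReach h *
      (G.playerReach π (G.player s) h / G.seqForm π ⟨s, a⟩) *
      G.playerReach π (1 - G.player s) h * G.nodeReward P π (G.player s) h| ≤ 1 / γ * R := by
    intro h hh
    have hn := (G.mem_below.1 hh).1
    have h1 := G.chanceReach_pos hn
    have h2 := G.chanceReach_le_one hn
    have h3 := hπ.playerReach_mem (G := G) (i := G.player s) (h := h)
    have h4 := hπ.playerReach_mem (G := G) (i := 1 - G.player s) (h := h)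
    have h5 := hγ.2 π hπ ⟨s, a⟩
    have h6 : G.playerReach π (G.player s) h / G.seqForm π ⟨s, a⟩ ≤ 1 / γ :=
      div_le_div₀ zero_le_one h3.2 hγ.1 h5
    have h7 : 0 < G.playerReach π (G.player s) h / G.seqForm π ⟨s, a⟩ :=
      div_pos h3.1 (hγ.1.trans_le h5)
    rw [abs_mul, abs_of_pos (mul_pos (mul_pos h1 h7) h4.1)]
    refine mul_le_mul ?_ (hreward π hπ _ h hn) (abs_nonneg _) (one_div_nonneg.2 hγ.1.le)
    calc _ ≤ 1 * (1 / γ) * 1 := mul_le_mul (mul_le_mul h2 h6 h7.le zero_le_one) h4.2 h4.1.le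
          (by have := hγ.1; positivity)
      _ = _ := by ring
  refine (Finset.abs_sum_le_sum_abs _ _).trans ((Finset.sum_le_sum hterm).trans ?_)
  rw [Finset.sum_const, nsmul_eq_mul]
  refine mul_le_mul_of_nonneg_right ?_ (mul_nonneg (one_div_nonneg.2 hγ.1.le) (by linarith))
  exact_mod_cast Finset.card_le_card fun h hh => (G.mem_below.1 hh).1

/-- The feedback is bounded by a constant that does not depend on the run. -/
theorem Game.IsReachBound.exists_feedback_bound (hγ : G.IsReachBound P γ) (f : Feedback) :
    ∃ B, ∀ (η : S → ℝ) (π πbar q : ℕ → Profile S A) (T : ℕ), IsRun G P f η π πbar q →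
      feedbackBound q T ≤ B := by
  obtain ⟨B, hB⟩ := hγ.exists_cfValue_bound
  have hM := hγ.M1_pos f
  have hfb : ∀ π, P.Feasible π → ∀ s a, |G.feedback P f π s a| ≤ B / G.M1 f γ := by
    intro π hπ s a
    have h1 := hB π hπ s a
    have h2 := hπ.weight_pos (G := G) f s
    rw [← hπ.weight_mul_feedback f, abs_mul, abs_of_pos h2] at h1
    rw [le_div_iff₀' hM]
    exact (mul_le_mul_of_nonneg_right (hγ.M1_le_weight hπ f s) (abs_nonneg _)).trans h1
  refine ⟨B / G.M1 f γ, fun η π πbar q T hrun => ?_⟩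
  have h0 : 0 ≤ B / G.M1 f γ := by
    obtain ⟨s⟩ := ‹Nonempty S›
    obtain ⟨a⟩ := ‹∀ s, Nonempty (A s)› s
    exact (abs_nonneg _).trans (hfb _ P.feasible_ν s a)
  refine Real.iSup_le (fun ⟨t, s, a⟩ => ?_) h0
  rcases (t : ℕ).eq_zero_or_pos with ht | ht
  · simp only [ht]
    rcases hrun.init_feedback with h | h
    · simpa [h] using h0
    · rw [h]; exact hfb _ (hrun.feasible 0) s a
  · simp only
    rw [hrun.feedback_eq _ ht]
    exact hfb _ (hrun.feasible _) s a

theorem Game.IsReachBound.bregman_le (hγ : G.IsReachBound P γ) (hx : P.Feasible x)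
    (hy : P.Feasible y) (s : S) :
    bregman (P.psi s) (x s) (y s) ≤ P.α s * (Fintype.card (A s) * (Real.log (1 / γ) + 1)) := by
  have hα := P.α_pos s
  have hL := log_one_div_nonneg hγ.1 (hγ.le_one hx)
  have hcard : (Fintype.card (A s) * (Real.log (1 / γ) + 1) : ℝ) =
      ∑ _a : A s, (Real.log (1 / γ) + 1) := by
    rw [Finset.sum_const, Finset.card_univ, nsmul_eq_mul]
  rcases hreg : P.reg with _ | _
  · rw [P.bregman_entropy hreg (hy.pos s), hcard]
    refine mul_le_mul_of_nonneg_left (Finset.sum_le_sum fun a _ => ?_) hα.le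
    have h1 := hx.pos s a
    have h2 := hx.le_one s a
    have h3 := hy.le_one s a
    have h4 : Real.log (x s a) ≤ 0 := Real.log_nonpos h1.le h2
    have h5 : -Real.log (1 / γ) ≤ Real.log (y s a) := by
      rw [one_div, Real.log_inv, neg_neg]; exact Real.log_le_log hγ.1 (hγ.le hy s a)
    have h6 : x s a * (Real.log (x s a) - Real.log (y s a)) ≤ x s a * Real.log (1 / γ) :=
      mul_le_mul_of_nonneg_left (by linarith) h1.le
    have h7 : x s a * Real.log (1 / γ) ≤ Real.log (1 / γ) := mul_le_of_le_one_left hL h2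
    linarith
  · rw [P.bregman_euclidean hreg (hy.pos s), hcard, div_mul_eq_mul_div, mul_div_assoc]
    refine mul_le_mul_of_nonneg_left ?_ hα.le
    have h0 : ∑ a, (x s a - y s a) ^ 2 ≤ ∑ _a : A s, (Real.log (1 / γ) + 1) :=
      Finset.sum_le_sum fun a _ => by
        have h1 := hx.pos s a
        have h2 := hx.le_one s a
        have h3 := hy.le_one s a
        have h4 := hy.pos s a
        nlinarith
    have : 0 ≤ ∑ a, (x s a - y s a) ^ 2 := Finset.sum_nonneg fun a _ => sq_nonneg _
    linarith

theorem Game.cDiff_mono (hQ : Q ≤ Q') (s : S) :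
    G.cDiff P f γ Q s ≤ G.cDiff P f γ Q' s := by
  have := P.α_pos s
  unfold Game.cDiff
  cases P.reg <;> simp only <;> gcongr

theorem Game.iSup_cDiff_mono (hQ : Q ≤ Q') :
    ⨆ s, G.cDiff P f γ Q s ≤ ⨆ s, G.cDiff P f γ Q' s :=
  ciSup_mono (Set.finite_range _).bddAbove fun s => G.cDiff_mono hQ s

theorem Game.cEnt_mono (hQ : Q ≤ Q') : G.cEnt P f γ Q ≤ G.cEnt P f γ Q' := by
  refine ciSup_mono (Set.finite_range _).bddAbove fun s => ?_
  have := P.α_pos s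
  gcongr

theorem Game.IsReachBound.cMinus_mono (hγ : G.IsReachBound P γ) (hQ : Q ≤ Q') (f' : Feedback)
    (s : S) : G.cMinus P f γ Q f' s ≤ G.cMinus P f γ Q' f' s := by
  have h1 := G.iSup_cDiff_mono (P := P) (f := f) (γ := γ) hQ
  have h2 := G.cEnt_mono (P := P) (f := f) (γ := γ) hQ
  have h3 := hγ.1
  unfold Game.cMinus
  cases f' <;> cases P.reg <;> simp only <;> first | exact le_rfl | gcongr

theorem Game.IsReachBound.cSlash_mono (hγ : G.IsReachBound P γ) (hQ : Q ≤ Q') (s : S) :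
    G.cSlash P f γ Q s ≤ G.cSlash P f γ Q' s := by
  have h1 := G.iSup_cDiff_mono (P := P) (f := f) (γ := γ) hQ
  have h2 := G.cEnt_mono (P := P) (f := f) (γ := γ) hQ
  have h3 := hγ.1
  have h4 := hγ.M1_pos f
  unfold Game.cSlash
  cases f <;> cases P.reg <;> simp only <;> first | exact le_rfl | gcongr

theorem iInf_rate_pos (hη : ∀ s, 0 < η s) : 0 < ⨅ s, η s := by
  obtain ⟨s, hs⟩ := exists_eq_ciInf_of_finite (f := η)
  rw [← hs]
  exact hη s

theorem Game.ancRate_le_iSup (hη : ∀ s, 0 < η s) (s : S) : G.ancRate η s ≤ ⨆ s, η s :=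
  Real.iSup_le (fun s' => le_ciSup (Set.finite_range η).bddAbove s'.1)
    (Real.iSup_nonneg fun s => (hη s).le)

/-- The explicit bound is of order `max η · T + 1 / min η`, with a constant that does not depend on
the run. -/
theorem Game.IsReachBound.exists_explicitBound_le (hγ : G.IsReachBound P γ) (f : Feedback) :
    ∃ K : ℝ, 0 ≤ K ∧ ∀ (x : Profile S A) (η : S → ℝ) (π πbar q : ℕ → Profile S A) (T : ℕ),
      P.Feasible x → IsRun G P f η π πbar q → (∀ s, 0 < η s) →
      G.explicitBound P f γ η π πbar q x T ≤
        K * ((⨆ s, η s) * T) + K * (1 / ⨅ s, η s) := by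
  obtain ⟨Q, hQ⟩ := hγ.exists_feedback_bound f
  choose B hB using P.exists_psi_bound
  have hν := P.feasible_ν
  have hγ0 := hγ.1
  have hτ := P.τ_pos
  have hw0 : 0 < ⨅ s, G.chanceMass s := G.iInf_chanceMass_pos
  have hM2 : 0 < M2 f γ := (hν.weight_pos f _).trans_le
    (hγ.weight_le hν f (Classical.arbitrary S))
  have hB0 : ∀ s, 0 ≤ B s := fun s => (abs_nonneg _).trans (hB s _ (hν s))
  have hL := log_one_div_nonneg hγ.1 (hγ.le_one hν)
  set Q₁ := max Q 0
  have hQ1 : 0 ≤ Q₁ := le_max_right _ _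
  set K₁ := 2 / (γ * ⨅ s, G.chanceMass s) *
    ∑ s, (G.cSlash P f γ Q₁ s + G.cMinus P f γ Q₁ .qValue s) * (2 * B s)
  set K₂ := 4 / (P.τ * γ * ⨅ s, G.chanceMass s) * ∑ s, G.cDiff P f γ Q₁ s * Q₁ * M2 f γ
  set K₃ := 2 / (P.τ * γ * ⨅ s, G.chanceMass s) *
    ∑ s, M2 f γ * (P.α s * (Fintype.card (A s) * (Real.log (1 / γ) + 1)))
  have hK₁ : 0 ≤ K₁ := mul_nonneg (by positivity) (Finset.sum_nonneg fun s _ =>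
    mul_nonneg (add_nonneg (hγ.cSlash_nonneg hν hQ1 s) (hγ.cMinus_nonneg hν hQ1 _ s))
      (by linarith [hB0 s]))
  have hK₂ : 0 ≤ K₂ := mul_nonneg (by positivity) (Finset.sum_nonneg fun s _ =>
    mul_nonneg (mul_nonneg (hγ.cDiff_nonneg hν hQ1 s) hQ1) hM2.le)
  have hK₃ : 0 ≤ K₃ := mul_nonneg (by positivity) (Finset.sum_nonneg fun s _ => by
    have := P.α_pos s
    positivity)
  refine ⟨K₁ + K₂ + K₃, by positivity, fun x η π πbar q T hx hrun hη => ?_⟩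
  have hfb : feedbackBound q T ≤ Q₁ := (hQ η π πbar q T hrun).trans (le_max_left _ _)
  have hfb0 : 0 ≤ feedbackBound q T := feedbackBound_nonneg
  set H := ⨆ s, η s
  set l := ⨅ s, η s
  have hl : 0 < l := iInf_rate_pos hη
  have hH : ∀ s, η s ≤ H := fun s => le_ciSup (Set.finite_range η).bddAbove s
  have hH0 : 0 ≤ H := Real.iSup_nonneg fun s => (hη s).le
  have h1 : 2 / (γ * ⨅ s, G.chanceMass s) *
      ∑ s, (G.cSlash P f γ (feedbackBound q T) s + G.cMinus P f γ (feedbackBound q T) .qValue s) *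
        G.ancRate η s * G.ownReach x s *
        ∑ t ∈ Finset.Icc 1 T, |P.psi s (π t s) - P.psi s (πbar (t + 1) s)| ≤ K₁ * (H * T) := by
    rw [mul_assoc, Finset.sum_mul]
    refine mul_le_mul_of_nonneg_left (Finset.sum_le_sum fun s _ => ?_) (by positivity)
    have ho := hx.ownReach_mem (G := G) s
    have ha := G.ancRate_nonneg (s := s) hη
    have ha' := G.ancRate_le_iSup (s := s) hη
    have hc := add_le_add (hγ.cSlash_mono (f := f) hfb s) (hγ.cMinus_mono (f := f) hfb .qValue s)
    have hc0 := add_nonneg (hγ.cSlash_nonneg (f := f) hν hfb0 s)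
      (hγ.cMinus_nonneg (f := f) hν hfb0 .qValue s)
    have hsum : ∑ t ∈ Finset.Icc 1 T, |P.psi s (π t s) - P.psi s (πbar (t + 1) s)| ≤
        T * (2 * B s) := by
      calc _ ≤ ∑ t ∈ Finset.Icc 1 T, 2 * B s := Finset.sum_le_sum fun t _ => by
            have h1 := hB s _ (hrun.feasible t s)
            have h2 := hB s _ (hrun.feasible_bar (t := t + 1) (by omega) s)
            have := abs_sub (P.psi s (π t s)) (P.psi s (πbar (t + 1) s))
            linarith
        _ = _ := by simp
    have hsum0 : 0 ≤ ∑ t ∈ Finset.Icc 1 T, |P.psi s (π t s) - P.psi s (πbar (t + 1) s)| :=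
      Finset.sum_nonneg fun _ _ => abs_nonneg _
    calc _ ≤ (G.cSlash P f γ Q₁ s + G.cMinus P f γ Q₁ .qValue s) * H * 1 * (T * (2 * B s)) := by
          refine mul_le_mul (mul_le_mul (mul_le_mul hc ha' ha (hc0.trans hc)) ho.2 ho.1.le ?_)
            hsum hsum0 ?_
          · exact mul_nonneg (hc0.trans hc) hH0
          · exact mul_nonneg (mul_nonneg (hc0.trans hc) hH0) zero_le_one
      _ = _ := by ring
  have h2 : 4 / (P.τ * γ * ⨅ s, G.chanceMass s) *
      ∑ s, G.cDiff P f γ (feedbackBound q T) s * G.ownReach x s * feedbackBound q T *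
        η s * M2 f γ * T ≤ K₂ * (H * T) := by
    rw [mul_assoc (4 / _), Finset.sum_mul]
    refine mul_le_mul_of_nonneg_left (Finset.sum_le_sum fun s _ => ?_) (by positivity)
    have ho := hx.ownReach_mem (G := G) s
    have hc := G.cDiff_mono (P := P) (f := f) (γ := γ) hfb s
    have hc0 := hγ.cDiff_nonneg (f := f) hν hfb0 s
    have hc1 := hc0.trans hc
    have hη0 := hη s
    calc _ ≤ G.cDiff P f γ Q₁ s * 1 * Q₁ * H * M2 f γ * T := by
          have := ho.1
          gcongr
          · exact ho.2
          · exact hH s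
      _ = _ := by ring
  have h3 : 2 / (P.τ * γ * ⨅ s, G.chanceMass s) *
      ∑ s, G.weight f (π 1) s / η s * G.ownReach x s * bregman (P.psi s) (x s) (πbar 1 s) ≤
      K₃ * (1 / l) := by
    rw [mul_assoc (2 / _), Finset.sum_mul]
    refine mul_le_mul_of_nonneg_left (Finset.sum_le_sum fun s _ => ?_) (by positivity)
    have ho := hx.ownReach_mem (G := G) s
    have hw := hγ.weight_le (hrun.feasible 1) f s
    have hw1 := (hrun.feasible 1).weight_pos (G := G) f s
    have hb := hγ.bregman_le hx hrun.init_feasible s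
    have hb0 := P.bregman_nonneg (s := s) (hx.pos s) (hrun.init_feasible.pos s)
    have hls : l ≤ η s := ciInf_le (Set.finite_range η).bddBelow s
    calc _ ≤ M2 f γ / l * 1 * (P.α s * (Fintype.card (A s) * (Real.log (1 / γ) + 1))) := by
          refine mul_le_mul (mul_le_mul (div_le_div₀ hM2.le hw hl hls) ho.2 ho.1.le ?_) hb hb0 ?_
          · positivity
          · positivity
      _ = _ := by ring
  have e1 : 0 ≤ H * T := by positivity
  have e2 : 0 ≤ 1 / l := by positivity
  have e3 := mul_nonneg hK₃ e1
  have e4 := mul_nonneg hK₁ e2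
  have e5 := mul_nonneg hK₂ e2
  unfold Game.explicitBound
  linarith

end

end EFG

theorem theorem2 {S : Type*} {A : S → Type*} {C : Type*} [Fintype S] [Nonempty S]
    [∀ s, Fintype (A s)] [∀ s, Nonempty (A s)] [Fintype C]
    (G : EFG.Game S A C) (P : EFG.Params S A) (f : EFG.Feedback) (γ : ℝ)
    (hγ : G.IsReachBound P γ) :
    -- the explicit bound
    (∀ (πstar : EFG.Profile S A) (η : S → ℝ) (π πbar q : ℕ → EFG.Profile S A) (T : ℕ),
      G.IsRegularizedNash P πstar → EFG.IsRun G P f η π πbar q →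
      EFG.RateConditions G P f γ (EFG.feedbackBound q T) η →
      ∑ t ∈ Finset.Icc 2 T, G.divergence P πstar (πbar t) ≤
        G.explicitBound P f γ η π πbar q πstar T) ∧
    -- its order, with a constant that depends on the game and the regularization only
    (∃ K : ℝ, ∀ (πstar : EFG.Profile S A) (η : S → ℝ) (π πbar q : ℕ → EFG.Profile S A) (T : ℕ),
      G.IsRegularizedNash P πstar → EFG.IsRun G P f η π πbar q →
      EFG.RateConditions G P f γ (EFG.feedbackBound q T) η →
      ∑ t ∈ Finset.Icc 2 T, G.divergence P πstar (πbar t) ≤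
        K * ((⨆ s, η s) * T) + K * (1 / ⨅ s, η s)) ∧
    -- best-iterate convergence for learning rates of order `1 / √T`
    (∀ c₁ c₂ : ℝ, 0 < c₁ → 0 < c₂ → ∃ K : ℝ,
      ∀ (πstar : EFG.Profile S A) (η : S → ℝ) (π πbar q : ℕ → EFG.Profile S A) (T : ℕ), 2 ≤ T →
      G.IsRegularizedNash P πstar → EFG.IsRun G P f η π πbar q →
      EFG.RateConditions G P f γ (EFG.feedbackBound q T) η →
      (∀ s, c₁ / √(T : ℝ) ≤ η s ∧ η s ≤ c₂ / √(T : ℝ)) →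
      ∃ t ∈ Finset.Icc 2 T, G.divergence P πstar (πbar t) ≤ K / √(T : ℝ)) := by
  obtain ⟨K, hK0, hK⟩ := hγ.exists_explicitBound_le f
  have hsum : ∀ (πstar : EFG.Profile S A) (η : S → ℝ) (π πbar q : ℕ → EFG.Profile S A) (T : ℕ),
      G.IsRegularizedNash P πstar → EFG.IsRun G P f η π πbar q →
      EFG.RateConditions G P f γ (EFG.feedbackBound q T) η →
      ∑ t ∈ Finset.Icc 2 T, G.divergence P πstar (πbar t) ≤
        K * ((⨆ s, η s) * T) + K * (1 / ⨅ s, η s) := fun πstar η π πbar q T hx hrun hr =>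
    (hrun.sum_divergence_le hγ hx hr).trans (hK πstar η π πbar q T hx.1 hrun hr.pos)
  refine ⟨fun πstar η π πbar q T hx hrun hr => hrun.sum_divergence_le hγ hx hr, ⟨K, hsum⟩, ?_⟩
  intro c₁ c₂ hc₁ hc₂
  refine ⟨2 * K * (c₂ + 1 / c₁), fun πstar η π πbar q T hT hx hrun hr hη => ?_⟩
  have hT' : (2 : ℝ) ≤ T := by exact_mod_cast hT
  set r := √(T : ℝ) with hrT
  have hr0 : 0 < r := Real.sqrt_pos.2 (by linarith)
  have hr2 : (T : ℝ) = r * r := (Real.mul_self_sqrt (by linarith)).symm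
  have hne : (Finset.Icc 2 T).Nonempty := ⟨2, by simpa using hT⟩
  have h1 := hsum πstar η π πbar q T hx hrun hr
  have h2 : K * ((⨆ s, η s) * T) ≤ K * (c₂ * r) := by
    refine mul_le_mul_of_nonneg_left ?_ hK0
    calc (⨆ s, η s) * T ≤ c₂ / r * T :=
          mul_le_mul_of_nonneg_right (ciSup_le fun s => (hη s).2) (by linarith)
      _ = c₂ * r := by rw [hr2]; field_simp
  have h3 : K * (1 / ⨅ s, η s) ≤ K * (1 / c₁ * r) := by
    refine mul_le_mul_of_nonneg_left ?_ hK0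
    calc 1 / ⨅ s, η s ≤ 1 / (c₁ / r) :=
          one_div_le_one_div_of_le (by positivity) (le_ciInf fun s => (hη s).1)
      _ = 1 / c₁ * r := by field_simp
  -- otherwise the `T - 1 ≥ T / 2` summands are too large
  by_contra! hlt
  have h4 := Finset.sum_lt_sum_of_nonempty hne fun t ht => hlt t ht
  rw [Finset.sum_const, Nat.card_Icc, nsmul_eq_mul, Nat.cast_sub (by omega)] at h4
  push_cast at h4
  have h5 : (T : ℝ) / 2 * (2 * K * (c₂ + 1 / c₁) / r) ≤
      ((T : ℝ) + 1 - 2) * (2 * K * (c₂ + 1 / c₁) / r) :=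
    mul_le_mul_of_nonneg_right (by linarith) (by positivity)
  have e : (T : ℝ) / 2 * (2 * K * (c₂ + 1 / c₁) / r) = K * (c₂ * r) + K * (1 / c₁ * r) := by
    rw [hr2]; field_simp
  linarith
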